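/- Let $U\subseteq\{(v,r): r>0\}$ be open, let $\beta,m:U\to\mathbb R$ be smooth, and consider the imploding spherically symmetric metric $$ds^2=-e^{2\beta(v,r)}\Big(1-\frac{2m(v,r)}{r}\Big)dv^2+2e^{\beta(v,r)}\,dv\,dr+r^2(d\theta^2+\sin^2\theta\,d\phi^2)$$ at the points with $(v,r)\in U$, $0<\theta<\pi$, time-oriented so that the null fields $$\ell=\partial_v+\tfrac12e^{\beta}\Big(1-\frac{2m}{r}\Big)\partial_r,\qquad n=-e^{-\beta}\partial_r$$ are future-directed. Let $\mathfrak m=\frac{1}{\sqrt2\,r}\big(\partial_\theta+\frac{i}{\sin\theta}\partial_\phi\big)$, let $C_{abcd}$ be the Weyl tensor, and put $\Psi_2=C_{abcd}\,\ell^a\mathfrak m^b\bar{\mathfrak m}^c n^d$, $\rho=-e^{\beta}(r-2m)/(2r^2)$, $$I_1=C_{abcd}C^{abcd},\qquad I_3=C_{abcd;e}C^{abcd;e},\qquad I_5=I_{1,a}I_1{}^{,a}.$$ Components in the tetrad $(\ell,n,\mathfrak m,\bar{\mathfrak m})$ are numbered $1,2,3,4$. Call a smooth hypersurface that is a union of round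 spheres $v=\mathrm{const}$, $r=\mathrm{const}$ a spherically symmetric marginally trapped tube if there are smooth future-directed null fields $\ell',n'$ near it, normal to the round spheres and linearly independent, such that on it the expansions of the round spheres satisfy $\theta_{(\ell')}=0$ and $\theta_{(n')}<0$. It is a future outer trapping horizon (FOTH) if, for such a choice, also $\mathcal L_{n'}\theta_{(\ell')}<0$ on it, and a dynamical horizon if it is also spacelike. Then: 1. Everywhere $$4I_1I_3-I_5=\frac{2^{11}3^3\,(r-2m)\,\Psi_2^4}{r^3}.$$ 2. The value of $4I_1I_3-I_5$ is independent of the frame: computed from the components of $g$, $C$, $\nabla C$ and $dI_1$ in any (real or complex) frame at a point, it is the same. 3. The structure of $\nabla C$ changes on $r=2m(v,r)$: everywhere $$C_{1214;3}=C_{1434;3}=C_{1213;4}=C_{1343;4}=3\rho\Psi_2 .$$ These components and $4I_1I_3-I_5$ vanish where $r=2m$. At a point with $\Psi_2\neq0$, $4I_1I_3-I_5=0$ if and only if $r=2m$. 4. The set $\{r=2m,\ 2m_{,r}<1\}$ is a spherically symmetric FOTH (possibly empty), and it contains every spherically symmetric FOTH. The set $\{r=2m,\ m_{,v}(1-2m_{,r})>0\}$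 is a spherically symmetric dynamical horizon (possibly empty), and every spherically symmetric dynamical horizon lies in $\{r=2m\}$. Hence $4I_1I_3-I_5$, whose definition involves no foliation, vanishes on every spherically symmetric FOTH and on every spherically symmetric dynamical horizon. -/

import Mathlib

open scoped ContDiff

noncomputable section

namespace SphHorizon

/-! Tensor calculus in a coordinate chart of a four-dimensional spacetime. A metric is its matrix of
coordinate components; tensor fields are families of component functions. -/

/-- Coordinate space. -/
abbrev Pt : Type := Fin 4 → ℝ

/-- A metric, given by its component matrix at every point. -/
abbrev Metric : Type := Pt → Matrix (Fin 4) (Fin 4) ℝ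

/-- The partial derivative along the `a`-th coordinate. -/
def pd (a : Fin 4) (f : Pt → ℝ) (x : Pt) : ℝ := fderiv ℝ f x (Pi.single a 1)

/-- `Γ^a_{bc}` for the Levi-Civita connection. -/
def christoffel (g : Metric) (x : Pt) (a b c : Fin 4) : ℝ :=
  (1 / 2) * ∑ d, (g x)⁻¹ a d *
    (pd b (fun y => g y d c) x + pd c (fun y => g y d b) x - pd d (fun y => g y b c) x)

/-- `R^a_{bcd} = ∂_c Γ^a_{db} - ∂_d Γ^a_{cb} + Γ^a_{ce} Γ^e_{db} - Γ^a_{de} Γ^e_{cb}`. -/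
def riemannUp (g : Metric) (x : Pt) (a b c d : Fin 4) : ℝ :=
  pd c (fun y => christoffel g y a d b) x - pd d (fun y => christoffel g y a c b) x
    + ∑ e, (christoffel g x a c e * christoffel g x e d b
        - christoffel g x a d e * christoffel g x e c b)

/-- `R_{abcd}`. -/
def riemann (g : Metric) (x : Pt) (a b c d : Fin 4) : ℝ :=
  ∑ e, g x a e * riemannUp g x e b c d

/-- `R_{bd} = R^a_{bad}`. -/
def ricci (g : Metric) (x : Pt) (b d : Fin 4) : ℝ := ∑ a, riemannUp g x a b a d

/-- The scalar curvature. -/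
def scalarCurv (g : Metric) (x : Pt) : ℝ := ∑ a, ∑ b, (g x)⁻¹ a b * ricci g x a b

/-- The Weyl tensor `C_{abcd}` in dimension four. -/
def weyl (g : Metric) (x : Pt) (a b c d : Fin 4) : ℝ :=
  riemann g x a b c d
    - (1 / 2) * (g x a c * ricci g x b d - g x a d * ricci g x b c
        - g x b c * ricci g x a d + g x b d * ricci g x a c)
    + (1 / 6) * scalarCurv g x * (g x a c * g x b d - g x a d * g x b c)

/-- The covariant derivative `C_{abcd;e}` of the Weyl tensor; the last index is the one of the
derivative. -/
def covWeyl (g : Metric) (x : Pt) (a b c d e : Fin 4) : ℝ :=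
  pd e (fun y => weyl g y a b c d) x
    - ∑ f, (christoffel g x f e a * weyl g x f b c d + christoffel g x f e b * weyl g x a f c d
        + christoffel g x f e c * weyl g x a b f d + christoffel g x f e d * weyl g x a b c f)

/-! Full contractions of covariant tensors of rank 1, 4 and 5 with themselves, `h` being the
inverse metric. -/

/-- `T_a T^a`. -/
def normSq1 {K : Type} [CommRing K] (h : Matrix (Fin 4) (Fin 4) K) (T : Fin 4 → K) : K :=
  ∑ a, ∑ a', h a a' * T a * T a'

/-- `T_{abcd} T^{abcd}`. -/
def normSq4 {K : Type} [CommRing K] (h : Matrix (Fin 4) (Fin 4) K)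
    (T : Fin 4 → Fin 4 → Fin 4 → Fin 4 → K) : K :=
  ∑ a, ∑ b, ∑ c, ∑ d, ∑ a', ∑ b', ∑ c', ∑ d',
    h a a' * h b b' * h c c' * h d d' * T a b c d * T a' b' c' d'

/-- `T_{abcde} T^{abcde}`. -/
def normSq5 {K : Type} [CommRing K] (h : Matrix (Fin 4) (Fin 4) K)
    (T : Fin 4 → Fin 4 → Fin 4 → Fin 4 → Fin 4 → K) : K :=
  ∑ a, ∑ b, ∑ c, ∑ d, ∑ e, ∑ a', ∑ b', ∑ c', ∑ d', ∑ e',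
    h a a' * h b b' * h c c' * h d d' * h e e' * T a b c d e * T a' b' c' d' e'

/-- `I₁ = C_{abcd} C^{abcd}`. -/
def I1 (g : Metric) (x : Pt) : ℝ := normSq4 (g x)⁻¹ (weyl g x)

/-- `I₃ = C_{abcd;e} C^{abcd;e}`. -/
def I3 (g : Metric) (x : Pt) : ℝ := normSq5 (g x)⁻¹ (covWeyl g x)

/-- `I₅ = I_{1,a} I_1^{,a}`. -/
def I5 (g : Metric) (x : Pt) : ℝ := normSq1 (g x)⁻¹ (fun a => pd a (I1 g) x)

/-- The scalar polynomial invariant `4 I₁ I₃ - I₅`. -/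
def spi (g : Metric) (x : Pt) : ℝ := 4 * I1 g x * I3 g x - I5 g x

/-! Components in a (possibly complex) frame `E`, whose `i`-th vector is `∑ a, E i a ∂_a`. -/

/-- Frame components of a covariant tensor of rank 1. -/
def comp1 (E : Matrix (Fin 4) (Fin 4) ℂ) (T : Fin 4 → ℝ) (i : Fin 4) : ℂ :=
  ∑ a, E i a * (T a : ℂ)

/-- Frame components of a covariant tensor of rank 4. -/
def comp4 (E : Matrix (Fin 4) (Fin 4) ℂ) (T : Fin 4 → Fin 4 → Fin 4 → Fin 4 → ℝ)
    (i j k l : Fin 4) : ℂ :=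
  ∑ a, ∑ b, ∑ c, ∑ d, E i a * E j b * E k c * E l d * (T a b c d : ℂ)

/-- Frame components of a covariant tensor of rank 5. -/
def comp5 (E : Matrix (Fin 4) (Fin 4) ℂ) (T : Fin 4 → Fin 4 → Fin 4 → Fin 4 → Fin 4 → ℝ)
    (i j k l n : Fin 4) : ℂ :=
  ∑ a, ∑ b, ∑ c, ∑ d, ∑ e, E i a * E j b * E k c * E l d * E n e * (T a b c d e : ℂ)

/-- The matrix `g(E_i, E_j)` of the metric in the frame `E` at `x`. -/
def frameMetric (g : Metric) (x : Pt) (E : Matrix (Fin 4) (Fin 4) ℂ) :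
    Matrix (Fin 4) (Fin 4) ℂ :=
  E * (g x).map (fun t : ℝ => (t : ℂ)) * E.transpose

/-- `4 I₁ I₃ - I₅` at `x`, evaluated from the components of the metric, of `C`, of `∇C` and of
`dI₁` in the frame `E`. -/
def frameSpi (g : Metric) (x : Pt) (E : Matrix (Fin 4) (Fin 4) ℂ) : ℂ :=
  4 * normSq4 (frameMetric g x E)⁻¹ (comp4 E (weyl g x))
      * normSq5 (frameMetric g x E)⁻¹ (comp5 E (covWeyl g x))
    - normSq1 (frameMetric g x E)⁻¹ (comp1 E (fun a => pd a (I1 g) x))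

/-! The imploding spherically symmetric metric. The coordinates `x 0, x 1, x 2, x 3` are
`v, r, θ, φ`. -/

/-- `-e^{2β} (1 - 2m/r) dv² + 2 e^β dv dr + r² (dθ² + sin² θ dφ²)`. -/
def implodingMetric (β m : ℝ → ℝ → ℝ) : Metric := fun x =>
  !![-(Real.exp (2 * β (x 0) (x 1)) * (1 - 2 * m (x 0) (x 1) / x 1)), Real.exp (β (x 0) (x 1)), 0, 0;
     Real.exp (β (x 0) (x 1)), 0, 0, 0;
     0, 0, (x 1) ^ 2, 0;
     0, 0, 0, (x 1) ^ 2 * (Real.sin (x 2)) ^ 2]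

/-- The points with `(v, r) ∈ U` and `0 < θ < π`. -/
def chartDomain (U : Set (ℝ × ℝ)) : Set Pt := {x | (x 0, x 1) ∈ U ∧ 0 < x 2 ∧ x 2 < Real.pi}

/-- The future outgoing radial null vector field `ℓ = ∂_v + (1/2) e^β (1 - 2m/r) ∂_r`. -/
def ell (β m : ℝ → ℝ → ℝ) (x : Pt) : Fin 4 → ℝ :=
  ![1, (1 / 2) * Real.exp (β (x 0) (x 1)) * (1 - 2 * m (x 0) (x 1) / x 1), 0, 0]

/-- The future ingoing radial null vector field `n = -e^{-β} ∂_r`, for which `ℓ · n = -1`. -/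
def enn (β : ℝ → ℝ → ℝ) (x : Pt) : Fin 4 → ℝ := ![0, -Real.exp (-β (x 0) (x 1)), 0, 0]

/-- The complex vector field `(∂_θ + (i / sin θ) ∂_φ) / (√2 r)`. -/
def emm (x : Pt) : Fin 4 → ℂ :=
  ![0, 0, 1 / ((Real.sqrt 2 * x 1 : ℝ) : ℂ),
    Complex.I / ((Real.sqrt 2 * x 1 * Real.sin (x 2) : ℝ) : ℂ)]

/-- The null tetrad `(ℓ, n, m, m̄)`. -/
def tetrad (β m : ℝ → ℝ → ℝ) (x : Pt) : Matrix (Fin 4) (Fin 4) ℂ :=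
  Matrix.of ![fun a => ((ell β m x a : ℝ) : ℂ), fun a => ((enn β x a : ℝ) : ℂ), emm x,
    fun a => (starRingEnd ℂ) (emm x a)]

/-- The Newman-Penrose Weyl scalar `Ψ₂ = C_{abcd} ℓ^a m^b m̄^c n^d`. -/
def psi2 (β m : ℝ → ℝ → ℝ) (x : Pt) : ℂ :=
  comp4 (tetrad β m x) (weyl (implodingMetric β m) x) 0 2 3 1

/-- The components of `∇C` in the null tetrad, the vectors `ℓ, n, m, m̄` being numbered
`0, 1, 2, 3`. -/
def tetradCovWeyl (β m : ℝ → ℝ → ℝ) (x : Pt) : Fin 4 → Fin 4 → Fin 4 → Fin 4 → Fin 4 → ℂ :=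
  comp5 (tetrad β m x) (covWeyl (implodingMetric β m) x)

/-- The Newman-Penrose spin coefficient `ρ = -e^β (r - 2m) / (2 r²)`. -/
def rho (β m : ℝ → ℝ → ℝ) (x : Pt) : ℝ :=
  -(Real.exp (β (x 0) (x 1)) * (x 1 - 2 * m (x 0) (x 1))) / (2 * (x 1) ^ 2)

/-! Horizons foliated by the round spheres `v = const`, `r = const`. -/

/-- The scalar product `g(X, Y)` at `x`. -/
def ip (g : Metric) (x : Pt) (X Y : Fin 4 → ℝ) : ℝ := ∑ a, ∑ b, g x a b * X a * Y b

/-- The metric induced on the coordinate sphere through `x`. -/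
def sphereMetric (g : Metric) (x : Pt) : Matrix (Fin 2) (Fin 2) ℝ :=
  (g x).submatrix ![2, 3] ![2, 3]

/-- The covariant derivative `∇_a k^b` of a vector field. -/
def covVec (g : Metric) (k : Pt → Fin 4 → ℝ) (x : Pt) (a b : Fin 4) : ℝ :=
  pd a (fun y => k y b) x + ∑ c, christoffel g x b a c * k x c

/-- The expansion `θ_(k) = q^{AB} ∇_A k_B` of the coordinate spheres along `k`. -/
def expansion (g : Metric) (k : Pt → Fin 4 → ℝ) (x : Pt) : ℝ :=
  ∑ A : Fin 2, ∑ B : Fin 2, (sphereMetric g x)⁻¹ A B *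
    ∑ c, g x (![2, 3] B) c * covVec g k x (![2, 3] A) c

/-- `f` is a local defining function on `V` of the smooth hypersurface `H`. -/
structure IsDefining (H V : Set Pt) (f : Pt → ℝ) : Prop where
  isOpen : IsOpen V
  smooth : ContDiffOn ℝ ∞ f V
  regular : ∀ y ∈ V, f y = 0 → fderiv ℝ f y ≠ 0
  zero_iff : ∀ y ∈ V, y ∈ H ↔ f y = 0

/-- The time orientation of the imploding metric, by the timelike field `ℓ + n`. -/
def timeField (β m : ℝ → ℝ → ℝ) (x : Pt) : Fin 4 → ℝ := fun a => ell β m x a + enn β x a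

/-- On `N`, `k` is a smooth future-directed null vector field normal to the round spheres. -/
structure IsFutureNullNormal (β m : ℝ → ℝ → ℝ) (N : Set Pt) (k : Pt → Fin 4 → ℝ) : Prop where
  smooth : ContDiffOn ℝ ∞ k N
  null : ∀ x ∈ N, ip (implodingMetric β m) x (k x) (k x) = 0
  future : ∀ x ∈ N, ip (implodingMetric β m) x (k x) (timeField β m x) < 0
  normal_theta : ∀ x ∈ N, ip (implodingMetric β m) x (k x) (Pi.single 2 1) = 0
  normal_phi : ∀ x ∈ N, ip (implodingMetric β m) x (k x) (Pi.single 3 1) = 0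

/-- `H` is a smooth hypersurface of the spacetime, foliated by round spheres on which one future
null normal `l` has zero expansion and the other one, `n`, has negative expansion. -/
structure IsTrappedTube (β m : ℝ → ℝ → ℝ) (U : Set (ℝ × ℝ)) (H N : Set Pt)
    (l n : Pt → Fin 4 → ℝ) : Prop where
  isOpen : IsOpen N
  subset_nhd : H ⊆ N
  nhd_subset : N ⊆ chartDomain U
  hypersurface : ∀ x ∈ H, ∃ V f, x ∈ V ∧ IsDefining H V f
  spheres : ∀ x ∈ H, ∀ y ∈ chartDomain U, y 0 = x 0 → y 1 = x 1 → y ∈ H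
  normal_l : IsFutureNullNormal β m N l
  normal_n : IsFutureNullNormal β m N n
  distinct : ∀ x ∈ N, ip (implodingMetric β m) x (l x) (n x) ≠ 0
  expansion_l : ∀ x ∈ H, expansion (implodingMetric β m) l x = 0
  expansion_n : ∀ x ∈ H, expansion (implodingMetric β m) n x < 0

/-- `H` is a spherically symmetric future outer trapping horizon: also `L_n θ_(l) < 0` on it. -/
def IsFOTH (β m : ℝ → ℝ → ℝ) (U : Set (ℝ × ℝ)) (H : Set Pt) : Prop :=
  ∃ N l n, IsTrappedTube β m U H N l n ∧
    ∀ x ∈ H, ∑ a, n x a * pd a (expansion (implodingMetric β m) l) x < 0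

/-- `H` is a spherically symmetric dynamical horizon: `H` is also spacelike, that is, its normal
covectors are timelike. -/
def IsDynamicalHorizon (β m : ℝ → ℝ → ℝ) (U : Set (ℝ × ℝ)) (H : Set Pt) : Prop :=
  ∃ N l n, IsTrappedTube β m U H N l n ∧
    ∀ x ∈ H, ∃ V f, x ∈ V ∧ IsDefining H V f ∧
      normSq1 (implodingMetric β m x)⁻¹ (fun a => pd a f x) < 0

end SphHorizon

end

/-!
Write `F = 1 - 2m/r = |∇r|²`. The imploding metric is a warped product: `g = h + q`, where `h` is a
metric of the `(v, r)`-plane and `q` is `r²` times the round metric of the sphere.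

*Curvature.* The Riemann tensor of a warped product is built from `h`, `q` and the Hessian of `r`, with
coefficients depending on `(v, r)` only (`SphChart.riemannUp_eq`). In dimension two the trace-free part
of the Hessian drops out of the Weyl tensor, so that `C = α K`, where `α` is a function of `(v, r)` and
`K = h ∧ h + q ∧ q - (h ∧ q) / 2` is algebraic in `h` and `q` (`SphChart.weyl_eq`). In the null tetrad
this reads `Ψ₂ = -α / 2`. As `∇_e q_{ab} = -(r_{,a} q_{be} + r_{,b} q_{ae}) / r = -∇_e h_{ab}`, also
`∇C = dα ⊗ K + (α / r) M`, where `M` is algebraic in `h`, `q` and `dr` (`SphChart.covWeyl_eq`). The third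
derivatives of the metric are thereby hidden in `dα`.

*Invariants.* A full contraction of a tensor with itself does not depend on the frame
(`FrameAction.pair_act_invariant`), so it may be evaluated in the null tetrad, where `h`, `q` and `K`
are constant matrices and only `ℓ(r)`, `n(r)`, `ℓ(α)`, `n(α)` remain. The result is
`I₁ = 48 Ψ₂²`, `I₃ = 48 |∇Ψ₂|² + 288 Ψ₂² F / r²`, `I₅ = 96² Ψ₂² |∇Ψ₂|²`; the terms with `|∇Ψ₂|²` cancel
in `4 I₁ I₃ - I₅` and the rest is the multiple of `F Ψ₂⁴ / r²` claimed. The four components of `∇C` come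
from `M` alone, and `ℓ(r) = -ρ r`.

*Horizons.* A future null field normal to the spheres is, pointwise, a positive multiple of `ℓ` or of
`n` (`IsFutureNullNormal.cases`), and its expansion is `2 k^r / r`. A field with zero expansion is
therefore a multiple of `ℓ` at a zero of `F`; near such a point it stays a multiple of `ℓ`, its expansion
is a positive function times `F`, and its derivative along the ingoing field has the sign of `-F_r`,
that is, of `2 m_r - 1` (`lie_expansion`). Conversely `ℓ` and `n` themselves make the sets in question
trapped tubes, with defining function `r - 2m`.
-/

noncomputable section

namespace SphHorizon

/-! ### Differential calculus of functions of `v` and `r` -/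

/-- `f` is differentiable at `x` with partial derivatives `f'`. -/
def HasGrad (f : Pt → ℝ) (f' : Fin 4 → ℝ) (x : Pt) : Prop :=
  DifferentiableAt ℝ f x ∧ ∀ a, pd a f x = f' a

namespace HasGrad

variable {f g : Pt → ℝ} {f' g' : Fin 4 → ℝ} {x : Pt}

theorem of_differentiableAt (h : DifferentiableAt ℝ f x) : HasGrad f (fun a => pd a f x) x :=
  ⟨h, fun _ => rfl⟩

theorem congr_grad (h : HasGrad f f' x) (e : ∀ a, f' a = g' a) : HasGrad f g' x :=
  ⟨h.1, fun a => (h.2 a).trans (e a)⟩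

theorem const (c : ℝ) : HasGrad (fun _ => c) 0 x :=
  ⟨differentiableAt_const c, fun a => by simp [pd]⟩

theorem coord (i : Fin 4) : HasGrad (fun y => y i) (Pi.single i 1) x := by
  have h : HasFDerivAt (fun y : Pt => y i) (ContinuousLinearMap.proj i : Pt →L[ℝ] ℝ) x :=
    (ContinuousLinearMap.proj i : Pt →L[ℝ] ℝ).hasFDerivAt
  refine ⟨h.differentiableAt, fun a => ?_⟩
  rw [pd, h.fderiv]
  simp [Pi.single_apply, eq_comm]

theorem add (hf : HasGrad f f' x) (hg : HasGrad g g' x) :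
    HasGrad (fun y => f y + g y) (fun a => f' a + g' a) x := by
  refine ⟨hf.1.fun_add hg.1, fun a => ?_⟩
  simp only [← hf.2, ← hg.2]
  rw [pd, fderiv_fun_add hf.1 hg.1]; rfl

theorem neg (hf : HasGrad f f' x) : HasGrad (fun y => -f y) (fun a => -f' a) x := by
  refine ⟨hf.1.fun_neg, fun a => ?_⟩
  simp only [← hf.2]
  rw [pd, fderiv_fun_neg]; rfl

theorem sub (hf : HasGrad f f' x) (hg : HasGrad g g' x) :
    HasGrad (fun y => f y - g y) (fun a => f' a - g' a) x := by
  simpa only [sub_eq_add_neg] using hf.add hg.neg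

theorem mul (hf : HasGrad f f' x) (hg : HasGrad g g' x) :
    HasGrad (fun y => f y * g y) (fun a => f' a * g x + f x * g' a) x := by
  refine ⟨hf.1.fun_mul hg.1, fun a => ?_⟩
  simp only [← hf.2, ← hg.2]
  rw [pd, fderiv_fun_mul hf.1 hg.1]
  simp only [pd, add_apply, smul_apply, smul_eq_mul]
  ring

theorem comp {φ : ℝ → ℝ} {φ' : ℝ} (hφ : HasDerivAt φ φ' (f x)) (hf : HasGrad f f' x) :
    HasGrad (fun y => φ (f y)) (fun a => φ' * f' a) x := by
  have h := hφ.comp_hasFDerivAt x hf.1.hasFDerivAt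
  refine ⟨h.differentiableAt, fun a => ?_⟩
  simp only [← hf.2]
  rw [pd, show (fun y => φ (f y)) = φ ∘ f from rfl, h.fderiv]
  rfl

theorem exp (hf : HasGrad f f' x) :
    HasGrad (fun y => Real.exp (f y)) (fun a => Real.exp (f x) * f' a) x :=
  comp (Real.hasDerivAt_exp _) hf

theorem inv (hf : HasGrad f f' x) (h0 : f x ≠ 0) :
    HasGrad (fun y => (f y)⁻¹) (fun a => -((f x) ^ 2)⁻¹ * f' a) x :=
  comp (φ := fun t => t⁻¹) (hasDerivAt_inv h0) hf

theorem sin (i : Fin 4) : HasGrad (fun y => Real.sin (y i))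
    (fun a => Real.cos (x i) * (Pi.single i 1 : Fin 4 → ℝ) a) x :=
  comp (f := fun y => y i) (Real.hasDerivAt_sin (x i)) (coord i)

theorem cos (i : Fin 4) : HasGrad (fun y => Real.cos (y i))
    (fun a => -Real.sin (x i) * (Pi.single i 1 : Fin 4 → ℝ) a) x :=
  comp (f := fun y => y i) (Real.hasDerivAt_cos (x i)) (coord i)

end HasGrad

theorem pd_congr {f g : Pt → ℝ} {D : Set Pt} (hD : IsOpen D) {x : Pt} (hx : x ∈ D)
    (h : ∀ y ∈ D, f y = g y) (a : Fin 4) : pd a f x = pd a g x := by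
  have e : f =ᶠ[nhds x] g := Filter.eventuallyEq_of_mem (hD.mem_nhds hx) h
  rw [pd, e.fderiv_eq]; rfl

theorem contDiffOn_pd {f : Pt → ℝ} {D : Set Pt} (hD : IsOpen D) (hf : ContDiffOn ℝ ∞ f D)
    (a : Fin 4) : ContDiffOn ℝ ∞ (pd a f) D :=
  (hf.fderiv_of_isOpen hD (m := ∞) le_rfl).clm_apply contDiffOn_const

theorem pd_comm {f : Pt → ℝ} {D : Set Pt} (hD : IsOpen D) (hf : ContDiffOn ℝ ∞ f D) {x : Pt}
    (hx : x ∈ D) (a b : Fin 4) : pd a (pd b f) x = pd b (pd a f) x := by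
  have h1 : ContDiffAt ℝ ∞ f x := hf.contDiffAt (hD.mem_nhds hx)
  have h2 : DifferentiableAt ℝ (fderiv ℝ f) x :=
    ((hf.fderiv_of_isOpen hD (m := ∞) le_rfl).contDiffAt (hD.mem_nhds hx)).differentiableAt
      (by simp)
  have key : ∀ i j : Fin 4, pd i (pd j f) x
      = fderiv ℝ (fderiv ℝ f) x (Pi.single i 1) (Pi.single j 1) := by
    intro i j
    rw [pd, show pd j f = fun y => fderiv ℝ f y (Pi.single j 1) from rfl,
      fderiv_clm_apply h2 (differentiableAt_const _)]
    simp
  rw [key, key]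
  refine (h1.isSymmSndFDerivAt ?_).eq _ _
  rw [minSmoothness_of_isRCLikeNormedField]
  exact WithTop.coe_le_coe.2 le_top

/-- Smooth functions of `v` and `r` alone on the open set `D`. -/
structure Radial (D : Set Pt) (f : Pt → ℝ) : Prop where
  smooth : ContDiffOn ℝ ∞ f D
  pd_two : ∀ x ∈ D, pd 2 f x = 0
  pd_three : ∀ x ∈ D, pd 3 f x = 0

namespace Radial

variable {D : Set Pt} {f g : Pt → ℝ} {x : Pt}

theorem differentiableAt (hf : Radial D f) (hD : IsOpen D) (hx : x ∈ D) :
    DifferentiableAt ℝ f x :=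
  (hf.smooth.contDiffAt (hD.mem_nhds hx)).differentiableAt (by simp)

theorem hasGrad (hf : Radial D f) (hD : IsOpen D) (hx : x ∈ D) :
    HasGrad f ![pd 0 f x, pd 1 f x, 0, 0] x :=
  ⟨hf.differentiableAt hD hx, fun a => by
    fin_cases a
    · rfl
    · rfl
    · exact hf.pd_two x hx
    · exact hf.pd_three x hx⟩

theorem of_hasGrad (hs : ContDiffOn ℝ ∞ f D)
    (h : ∀ x ∈ D, ∃ f' : Fin 4 → ℝ, HasGrad f f' x ∧ f' 2 = 0 ∧ f' 3 = 0) : Radial D f :=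
  ⟨hs, fun x hx => by obtain ⟨f', h1, h2, _⟩ := h x hx; rw [h1.2, h2],
    fun x hx => by obtain ⟨f', h1, _, h2⟩ := h x hx; rw [h1.2, h2]⟩

theorem const (c : ℝ) : Radial D (fun _ => c) :=
  of_hasGrad contDiffOn_const fun _ _ => ⟨_, .const c, rfl, rfl⟩

theorem coord_one : Radial D (fun y => y 1) :=
  of_hasGrad (contDiff_apply ℝ ℝ (1 : Fin 4)).contDiffOn
    fun _ _ => ⟨_, .coord 1, by simp, by simp⟩

theorem add (hD : IsOpen D) (hf : Radial D f) (hg : Radial D g) :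
    Radial D (fun y => f y + g y) :=
  of_hasGrad (hf.smooth.add hg.smooth)
    fun _ hx => ⟨_, (hf.hasGrad hD hx).add (hg.hasGrad hD hx), by simp, by simp⟩

theorem mul (hD : IsOpen D) (hf : Radial D f) (hg : Radial D g) :
    Radial D (fun y => f y * g y) :=
  of_hasGrad (hf.smooth.mul hg.smooth)
    fun _ hx => ⟨_, (hf.hasGrad hD hx).mul (hg.hasGrad hD hx), by simp, by simp⟩

theorem neg (hD : IsOpen D) (hf : Radial D f) : Radial D (fun y => -f y) :=
  of_hasGrad hf.smooth.neg
    fun _ hx => ⟨_, (hf.hasGrad hD hx).neg, by simp, by simp⟩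

theorem sub (hD : IsOpen D) (hf : Radial D f) (hg : Radial D g) :
    Radial D (fun y => f y - g y) :=
  of_hasGrad (hf.smooth.sub hg.smooth)
    fun _ hx => ⟨_, (hf.hasGrad hD hx).sub (hg.hasGrad hD hx), by simp, by simp⟩

theorem exp (hD : IsOpen D) (hf : Radial D f) : Radial D (fun y => Real.exp (f y)) :=
  of_hasGrad hf.smooth.exp fun _ hx => ⟨_, (hf.hasGrad hD hx).exp, by simp, by simp⟩

theorem inv (hD : IsOpen D) (hf : Radial D f) (h0 : ∀ x ∈ D, f x ≠ 0) :
    Radial D (fun y => (f y)⁻¹) :=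
  of_hasGrad (hf.smooth.inv h0)
    fun _ hx => ⟨_, (hf.hasGrad hD hx).inv (h0 _ hx), by simp, by simp⟩

theorem pd (hD : IsOpen D) (hf : Radial D f) (a : Fin 4) : Radial D (pd a f) := by
  refine ⟨contDiffOn_pd hD hf.smooth a, fun x hx => ?_, fun x hx => ?_⟩
  · rw [pd_comm hD hf.smooth hx, pd_congr hD hx hf.pd_two]
    exact (HasGrad.const 0).2 a
  · rw [pd_comm hD hf.smooth hx, pd_congr hD hx hf.pd_three]
    exact (HasGrad.const 0).2 a

end Radial

/-- The metric `-e^{2b} F dv² + 2 e^b dv dr + r² (dθ² + sin² θ dφ²)`. -/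
def sphMetric (b F : Pt → ℝ) : Metric := fun x =>
  !![-(Real.exp (b x) ^ 2 * F x), Real.exp (b x), 0, 0;
     Real.exp (b x), 0, 0, 0;
     0, 0, (x 1) ^ 2, 0;
     0, 0, 0, (x 1) ^ 2 * (Real.sin (x 2)) ^ 2]

/-- The inverse of `sphMetric`. -/
def sphInv (b F : Pt → ℝ) (x : Pt) : Matrix (Fin 4) (Fin 4) ℝ :=
  !![0, (Real.exp (b x))⁻¹, 0, 0;
     (Real.exp (b x))⁻¹, F x, 0, 0;
     0, 0, ((x 1) ^ 2)⁻¹, 0;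
     0, 0, 0, ((x 1) ^ 2 * (Real.sin (x 2)) ^ 2)⁻¹]

/-- The setting of the computation: `D` is an open set of points with `r > 0` and `sin θ ≠ 0` on which `b` and `F` are smooth
functions of `v` and `r`. -/
structure SphChart (D : Set Pt) (b F : Pt → ℝ) : Prop where
  isOpen : IsOpen D
  r_ne : ∀ x ∈ D, x 1 ≠ 0
  sin_ne : ∀ x ∈ D, Real.sin (x 2) ≠ 0
  hb : Radial D b
  hF : Radial D F

/-- The surface gravity `k = e^b (b_r F + F_r / 2) = -Γ^r_{vr}`. -/
def grav (b F : Pt → ℝ) (x : Pt) : ℝ :=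
  Real.exp (b x) * (pd 1 b x * F x + 1 / 2 * pd 1 F x)

/-- `Γ^r_{vv}`. -/
def accel (b F : Pt → ℝ) (x : Pt) : ℝ :=
  Real.exp (b x) * (F x * grav b F x - 1 / 2 * pd 0 F x)

/-- The Christoffel symbols `Γ^a_{bc}` of `sphMetric`. -/
def gam (b F : Pt → ℝ) (x : Pt) : Fin 4 → Matrix (Fin 4) (Fin 4) ℝ
  | 0 => !![pd 0 b x + grav b F x, 0, 0, 0;
            0, 0, 0, 0;
            0, 0, -(x 1 * (Real.exp (b x))⁻¹), 0;
            0, 0, 0, -(x 1 * (Real.exp (b x))⁻¹ * (Real.sin (x 2) * Real.sin (x 2)))]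
  | 1 => !![accel b F x, -grav b F x, 0, 0;
            -grav b F x, pd 1 b x, 0, 0;
            0, 0, -(x 1 * F x), 0;
            0, 0, 0, -(x 1 * F x * (Real.sin (x 2) * Real.sin (x 2)))]
  | 2 => !![0, 0, 0, 0;
            0, 0, (x 1)⁻¹, 0;
            0, (x 1)⁻¹, 0, 0;
            0, 0, 0, -(Real.sin (x 2) * Real.cos (x 2))]
  | 3 => !![0, 0, 0, 0;
            0, 0, 0, (x 1)⁻¹;
            0, 0, 0, Real.cos (x 2) * (Real.sin (x 2))⁻¹;
            0, (x 1)⁻¹, Real.cos (x 2) * (Real.sin (x 2))⁻¹, 0]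

/-- The partial derivatives `∂_e g_{ac}` of `sphMetric`, as a matrix in `a`, `c`. -/
def pdMetric (b F : Pt → ℝ) (x : Pt) : Fin 4 → Matrix (Fin 4) (Fin 4) ℝ
  | 0 => !![-(Real.exp (b x) ^ 2 * (2 * pd 0 b x * F x + pd 0 F x)), Real.exp (b x) * pd 0 b x, 0, 0;
            Real.exp (b x) * pd 0 b x, 0, 0, 0;
            0, 0, 0, 0;
            0, 0, 0, 0]
  | 1 => !![-(Real.exp (b x) ^ 2 * (2 * pd 1 b x * F x + pd 1 F x)), Real.exp (b x) * pd 1 b x, 0, 0;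
            Real.exp (b x) * pd 1 b x, 0, 0, 0;
            0, 0, 2 * x 1, 0;
            0, 0, 0, 2 * x 1 * Real.sin (x 2) ^ 2]
  | 2 => !![0, 0, 0, 0;
            0, 0, 0, 0;
            0, 0, 0, 0;
            0, 0, 0, 2 * (x 1) ^ 2 * Real.sin (x 2) * Real.cos (x 2)]
  | 3 => 0

namespace SphChart

variable {D : Set Pt} {b F : Pt → ℝ} {x : Pt}

theorem inv_eq (h : SphChart D b F) (hx : x ∈ D) : (sphMetric b F x)⁻¹ = sphInv b F x := by
  have h1 := h.r_ne x hx
  have h2 := h.sin_ne x hx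
  have h3 := Real.exp_ne_zero (b x)
  apply Matrix.inv_eq_right_inv
  ext i j
  fin_cases i <;> fin_cases j <;>
    simp [sphMetric, sphInv, Matrix.mul_apply, Fin.sum_univ_four] <;> field_simp
  all_goals simp

theorem pd_metric (h : SphChart D b F) (hx : x ∈ D) (e a c : Fin 4) :
    pd e (fun y => sphMetric b F y a c) x = pdMetric b F x e a c := by
  have gb := (h.hb.hasGrad h.isOpen hx).exp
  have gF := h.hF.hasGrad h.isOpen hx
  have g00 := ((gb.mul gb).mul gF).neg.2
  have g22 := ((HasGrad.coord (x := x) 1).mul (HasGrad.coord 1)).2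
  have g33 := (((HasGrad.coord (x := x) 1).mul (HasGrad.coord 1)).mul
    ((HasGrad.sin 2).mul (HasGrad.sin 2))).2
  have g0 := (HasGrad.const (x := x) 0).2
  -- every entry of the metric is one of five functions
  have g01 := gb.2
  fin_cases a <;> fin_cases c <;> simp only [sphMetric, pow_two] <;>
    simp only [Matrix.of_apply, Matrix.cons_val', Matrix.cons_val_zero, Matrix.cons_val_one,
      Matrix.cons_val, Fin.zero_eta, Fin.mk_one, Fin.reduceFinMk, Matrix.cons_val_fin_one] <;>
    first
      | rw [g00 e] | rw [g01 e] | rw [g22 e] | rw [g33 e] | rw [g0 e]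
  all_goals (fin_cases e <;> simp [pdMetric] <;> ring1)

theorem christoffel_eq (h : SphChart D b F) (hx : x ∈ D) (a c d : Fin 4) :
    christoffel (sphMetric b F) x a c d = gam b F x a c d := by
  have h1 := h.r_ne x hx
  have h2 := h.sin_ne x hx
  have h3 := Real.exp_ne_zero (b x)
  simp only [christoffel, h.inv_eq hx, h.pd_metric hx, Fin.sum_univ_four]
  fin_cases a <;> fin_cases c <;> fin_cases d <;>
    simp [sphInv, pdMetric, gam, accel, grav] <;> field_simp <;> ring

end SphChart

/-! ### Curvature data of the warped product -/

/-- The `(v, r)`-part of `sphMetric`. -/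
def radMetric (b F : Pt → ℝ) (x : Pt) : Matrix (Fin 4) (Fin 4) ℝ :=
  !![-(Real.exp (b x) * Real.exp (b x) * F x), Real.exp (b x), 0, 0;
     Real.exp (b x), 0, 0, 0;
     0, 0, 0, 0;
     0, 0, 0, 0]

/-- The part of `sphMetric` tangent to the round spheres. -/
def angMetric (x : Pt) : Matrix (Fin 4) (Fin 4) ℝ :=
  !![0, 0, 0, 0;
     0, 0, 0, 0;
     0, 0, x 1 * x 1, 0;
     0, 0, 0, x 1 * x 1 * (Real.sin (x 2) * Real.sin (x 2))]

/-- The projection onto the `(v, r)`-plane. -/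
def radProj : Matrix (Fin 4) (Fin 4) ℝ :=
  !![1, 0, 0, 0; 0, 1, 0, 0; 0, 0, 0, 0; 0, 0, 0, 0]

/-- The projection onto the tangent plane of the round sphere. -/
def angProj : Matrix (Fin 4) (Fin 4) ℝ :=
  !![0, 0, 0, 0; 0, 0, 0, 0; 0, 0, 1, 0; 0, 0, 0, 1]

/-- The `(v, r)`-block of `-∇_a ∇_b r / r`. -/
def radHess (b F : Pt → ℝ) (x : Pt) : Matrix (Fin 4) (Fin 4) ℝ :=
  !![accel b F x * (x 1)⁻¹, -(grav b F x * (x 1)⁻¹), 0, 0;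
     -(grav b F x * (x 1)⁻¹), pd 1 b x * (x 1)⁻¹, 0, 0;
     0, 0, 0, 0;
     0, 0, 0, 0]

/-- `radHess` with its first index raised. -/
def radHessUp (b F : Pt → ℝ) (x : Pt) : Matrix (Fin 4) (Fin 4) ℝ :=
  !![-(grav b F x * (x 1)⁻¹ * (Real.exp (b x))⁻¹), pd 1 b x * (x 1)⁻¹ * (Real.exp (b x))⁻¹, 0, 0;
     -(1 / 2 * pd 0 F x * (x 1)⁻¹), -(1 / 2 * pd 1 F x * (x 1)⁻¹), 0, 0;
     0, 0, 0, 0;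
     0, 0, 0, 0]

/-- The trace of `radHess`. -/
def radHessTr (b F : Pt → ℝ) (x : Pt) : ℝ :=
  -((pd 1 b x * F x + pd 1 F x) * (x 1)⁻¹)

/-- The Gaussian curvature of the `(v, r)`-part of the metric. -/
def gaussCurv (b F : Pt → ℝ) (x : Pt) : ℝ :=
  -((Real.exp (b x))⁻¹ * (pd 1 (pd 0 b) x + pd 1 (grav b F) x))

/-- The sectional curvature `(1 - F) / r²` of the planes tangent to the round spheres. -/
def angCurv (F : Pt → ℝ) (x : Pt) : ℝ := (1 - F x) * (x 1 * x 1)⁻¹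

/-- The partial derivatives `∂_e Γ^a_{cd}`, as a matrix in `c`, `d`. -/
def pdGam (b F : Pt → ℝ) (x : Pt) : Fin 4 → Fin 4 → Matrix (Fin 4) (Fin 4) ℝ
  | 0, 0 => !![pd 0 (pd 0 b) x + pd 0 (grav b F) x, 0, 0, 0;
      0, 0, 0, 0;
      0, 0, x 1 * (Real.exp (b x))⁻¹ * pd 0 b x, 0;
      0, 0, 0, x 1 * (Real.exp (b x))⁻¹ * pd 0 b x * (Real.sin (x 2) * Real.sin (x 2))]
  | 0, 1 => !![pd 0 (accel b F) x, -pd 0 (grav b F) x, 0, 0;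
      -pd 0 (grav b F) x, pd 0 (pd 1 b) x, 0, 0;
      0, 0, -(x 1 * pd 0 F x), 0;
      0, 0, 0, -(x 1 * pd 0 F x * (Real.sin (x 2) * Real.sin (x 2)))]
  | 1, 0 => !![pd 1 (pd 0 b) x + pd 1 (grav b F) x, 0, 0, 0;
      0, 0, 0, 0;
      0, 0, (x 1 * pd 1 b x - 1) * (Real.exp (b x))⁻¹, 0;
      0, 0, 0, (x 1 * pd 1 b x - 1) * (Real.exp (b x))⁻¹ * (Real.sin (x 2) * Real.sin (x 2))]
  | 1, 1 => !![pd 1 (accel b F) x, -pd 1 (grav b F) x, 0, 0;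
      -pd 1 (grav b F) x, pd 1 (pd 1 b) x, 0, 0;
      0, 0, -(F x + x 1 * pd 1 F x), 0;
      0, 0, 0, -((F x + x 1 * pd 1 F x) * (Real.sin (x 2) * Real.sin (x 2)))]
  | 1, 2 => !![0, 0, 0, 0;
      0, 0, -((x 1) ^ 2)⁻¹, 0;
      0, -((x 1) ^ 2)⁻¹, 0, 0;
      0, 0, 0, 0]
  | 1, 3 => !![0, 0, 0, 0;
      0, 0, 0, -((x 1) ^ 2)⁻¹;
      0, 0, 0, 0;
      0, -((x 1) ^ 2)⁻¹, 0, 0]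
  | 2, 0 => !![0, 0, 0, 0;
      0, 0, 0, 0;
      0, 0, 0, 0;
      0, 0, 0, -(2 * (x 1 * (Real.exp (b x))⁻¹) * (Real.sin (x 2) * Real.cos (x 2)))]
  | 2, 1 => !![0, 0, 0, 0;
      0, 0, 0, 0;
      0, 0, 0, 0;
      0, 0, 0, -(2 * (x 1 * F x) * (Real.sin (x 2) * Real.cos (x 2)))]
  | 2, 2 => !![0, 0, 0, 0;
      0, 0, 0, 0;
      0, 0, 0, 0;
      0, 0, 0, Real.sin (x 2) ^ 2 - Real.cos (x 2) ^ 2]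
  | 2, 3 => !![0, 0, 0, 0;
      0, 0, 0, 0;
      0, 0, 0, -1 - Real.cos (x 2) ^ 2 * (Real.sin (x 2) ^ 2)⁻¹;
      0, 0, -1 - Real.cos (x 2) ^ 2 * (Real.sin (x 2) ^ 2)⁻¹, 0]
  | _, _ => 0

theorem sphMetric_eq_add (b F : Pt → ℝ) (x : Pt) :
    sphMetric b F x = radMetric b F x + angMetric x := by
  ext i j
  fin_cases i <;> fin_cases j <;> simp [sphMetric, radMetric, angMetric, pow_two]

namespace SphChart

variable {D : Set Pt} {b F : Pt → ℝ} {x : Pt}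

theorem radial_grav (h : SphChart D b F) : Radial D (grav b F) :=
  .mul h.isOpen (.exp h.isOpen h.hb) (.add h.isOpen (.mul h.isOpen (.pd h.isOpen h.hb 1) h.hF)
    (.mul h.isOpen (.const _) (.pd h.isOpen h.hF 1)))

theorem radial_accel (h : SphChart D b F) : Radial D (accel b F) :=
  .mul h.isOpen (.exp h.isOpen h.hb) (.sub h.isOpen (.mul h.isOpen h.hF h.radial_grav)
    (.mul h.isOpen (.const _) (.pd h.isOpen h.hF 0)))

/-- The mixed derivatives are written with `∂_r` outermost, as in `pd_one_accel`. -/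
theorem pd_zero_grav (h : SphChart D b F) (hx : x ∈ D) :
    pd 0 (grav b F) x = pd 0 b x * grav b F x + Real.exp (b x) *
      (pd 1 (pd 0 b) x * F x + pd 1 b x * pd 0 F x + 1 / 2 * pd 1 (pd 0 F) x) := by
  have hO := h.isOpen
  have g := ((h.hb.hasGrad hO hx).exp.mul ((((h.hb.pd hO 1).hasGrad hO hx).mul
    (h.hF.hasGrad hO hx)).add ((HasGrad.const (1 / 2)).mul ((h.hF.pd hO 1).hasGrad hO hx)))).2 0
  refine g.trans ?_
  rw [← pd_comm hO h.hb.smooth hx 0 1, ← pd_comm hO h.hF.smooth hx 0 1]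
  simp [grav]
  ring

theorem pd_one_accel (h : SphChart D b F) (hx : x ∈ D) :
    pd 1 (accel b F) x = pd 1 b x * accel b F x + Real.exp (b x) *
      (pd 1 F x * grav b F x + F x * pd 1 (grav b F) x - 1 / 2 * pd 1 (pd 0 F) x) := by
  have hO := h.isOpen
  have g := ((h.hb.hasGrad hO hx).exp.mul (((h.hF.hasGrad hO hx).mul
    (h.radial_grav.hasGrad hO hx)).sub ((HasGrad.const (1 / 2)).mul
    ((h.hF.pd hO 0).hasGrad hO hx)))).2 1
  refine g.trans ?_
  simp [accel]
  ring

theorem pd_gam (h : SphChart D b F) (hx : x ∈ D) (e a c d : Fin 4) :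
    pd e (fun y => gam b F y a c d) x = pdGam b F x e a c d := by
  have hO := h.isOpen
  have h1 := h.r_ne x hx
  have h2 := h.sin_ne x hx
  have h3 := Real.exp_ne_zero (b x)
  have gb := h.hb.hasGrad hO hx
  have gF := h.hF.hasGrad hO hx
  have gr := HasGrad.coord (x := x) 1
  have gs := HasGrad.sin (x := x) 2
  have gE := gb.exp.inv h3
  -- the gradients of the eleven functions, other than zero, among the Christoffel symbols
  have e1 := (((h.hb.pd hO 0).hasGrad hO hx).add (h.radial_grav.hasGrad hO hx)).2 e
  have e2 := (gr.mul gE).neg.2 e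
  have e3 := ((gr.mul gE).mul (gs.mul gs)).neg.2 e
  have e4 := (h.radial_accel.hasGrad hO hx).2 e
  have e5 := (h.radial_grav.hasGrad hO hx).neg.2 e
  have e6 := ((h.hb.pd hO 1).hasGrad hO hx).2 e
  have e7 := (gr.mul gF).neg.2 e
  have e8 := ((gr.mul gF).mul (gs.mul gs)).neg.2 e
  have e9 := (gr.inv h1).2 e
  have e10 := (gs.mul (HasGrad.cos 2)).neg.2 e
  have e11 := ((HasGrad.cos (x := x) 2).mul (gs.inv h2)).2 e
  have e0 := (HasGrad.const (x := x) 0).2 e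
  fin_cases a <;> fin_cases c <;> fin_cases d <;>
    simp only [gam, Matrix.of_apply, Matrix.cons_val', Matrix.cons_val_zero, Matrix.cons_val_one,
      Matrix.cons_val, Fin.zero_eta, Fin.mk_one, Fin.reduceFinMk, Matrix.cons_val_fin_one]
  all_goals first
    | rw [e0] | rw [e1] | rw [e2] | rw [e3] | refine e4.trans ?_ | rw [e5] | refine e6.trans ?_
    | rw [e7] | rw [e8] | rw [e9] | rw [e10] | rw [e11]
  all_goals (fin_cases e <;> simp [pdGam] <;> field_simp <;> first | ring1 | exact Or.inl trivial)

end SphChart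

/-! ### The Riemann and Weyl tensors -/

namespace SphChart

variable {D : Set Pt} {b F : Pt → ℝ} {x : Pt}

set_option maxHeartbeats 4000000 in
/-- The formula of `riemannUp_eq`, for the six pairs `c < d` that determine the others. -/
theorem riemannUp_eq_of_lt (h : SphChart D b F) (hx : x ∈ D) (a p c d : Fin 4) (hcd : c < d) :
    riemannUp (sphMetric b F) x a p c d =
      gaussCurv b F x * (radProj a c * radMetric b F x p d - radProj a d * radMetric b F x p c)
      + angCurv F x * (angProj a c * angMetric x p d - angProj a d * angMetric x p c)
      + (radHessUp b F x a c * angMetric x p d + angProj a c * radHess b F x p d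
        - radHessUp b F x a d * angMetric x p c - angProj a d * radHess b F x p c) := by
  have hΓ : ∀ i j k l : Fin 4, pd i (fun y => christoffel (sphMetric b F) y j k l) x
      = pdGam b F x i j k l := fun i j k l => by
    rw [pd_congr h.isOpen hx (fun y hy => h.christoffel_eq hy j k l), h.pd_gam hx]
  simp only [riemannUp, hΓ, h.christoffel_eq hx, Fin.sum_univ_four]
  have h1 := h.r_ne x hx
  have h2 := h.sin_ne x hx
  have h3 := Real.exp_ne_zero (b x)
  have q := h.pd_one_accel hx
  have k := h.pd_zero_grav hx
  have hc := Real.cos_sq' (x 2)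
  have hb := pd_comm h.isOpen h.hb.smooth hx 0 1
  fin_cases c <;> fin_cases d <;> (try (exfalso; revert hcd; decide)) <;> fin_cases a <;> fin_cases p <;>
    simp [gam, pdGam, radProj, angProj, radMetric, angMetric, radHess, radHessUp, gaussCurv,
      angCurv, q, k, hb] <;>
    (try simp only [accel, grav]) <;> field_simp <;> (try rw [hc]) <;> ring1

/-- The curvature of the warped product of the `(v, r)`-plane and the round sphere. -/
theorem riemannUp_eq (h : SphChart D b F) (hx : x ∈ D) (a p c d : Fin 4) :
    riemannUp (sphMetric b F) x a p c d =
      gaussCurv b F x * (radProj a c * radMetric b F x p d - radProj a d * radMetric b F x p c)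
      + angCurv F x * (angProj a c * angMetric x p d - angProj a d * angMetric x p c)
      + (radHessUp b F x a c * angMetric x p d + angProj a c * radHess b F x p d
        - radHessUp b F x a d * angMetric x p c - angProj a d * radHess b F x p c) := by
  have key := h.riemannUp_eq_of_lt hx a p
  have anti : ∀ i j, riemannUp (sphMetric b F) x a p i j
      = -riemannUp (sphMetric b F) x a p j i := fun i j => by
    simp only [riemannUp, Finset.sum_sub_distrib]
    ring
  rcases lt_trichotomy c d with hcd | rfl | hcd
  · exact key c d hcd
  · linear_combination (1 / 2) * anti c c
  · rw [anti, key d c hcd]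
    ring

theorem riemann_eq (h : SphChart D b F) (hx : x ∈ D) (a p c d : Fin 4) :
    riemann (sphMetric b F) x a p c d =
      gaussCurv b F x *
        (radMetric b F x a c * radMetric b F x p d - radMetric b F x a d * radMetric b F x p c)
      + angCurv F x * (angMetric x a c * angMetric x p d - angMetric x a d * angMetric x p c)
      + (radHess b F x a c * angMetric x p d + angMetric x a c * radHess b F x p d
        - radHess b F x a d * angMetric x p c - angMetric x a d * radHess b F x p c) := by
  have h1 := h.r_ne x hx
  have h3 := Real.exp_ne_zero (b x)
  -- lowering the first index turns the projections and `radHessUp` into `h`, `q` and `radHess`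
  have e1 : sphMetric b F x * radProj = radMetric b F x := by
    ext i j
    fin_cases i <;> fin_cases j <;>
      simp [Matrix.mul_apply, Fin.sum_univ_four, sphMetric, radProj, radMetric, pow_two]
  have e2 : sphMetric b F x * angProj = angMetric x := by
    ext i j
    fin_cases i <;> fin_cases j <;>
      simp [Matrix.mul_apply, Fin.sum_univ_four, sphMetric, angProj, angMetric, pow_two]
  have e3 : sphMetric b F x * radHessUp b F x = radHess b F x := by
    ext i j
    fin_cases i <;> fin_cases j <;>
      simp [Matrix.mul_apply, Fin.sum_univ_four, sphMetric, radHessUp, radHess] <;>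
      (try simp only [accel, grav]) <;> field_simp <;> ring
  simp only [riemann, h.riemannUp_eq hx]
  rw [← e1, ← e2, ← e3]
  simp only [Matrix.mul_apply, Fin.sum_univ_four]
  ring

theorem ricci_eq (h : SphChart D b F) (hx : x ∈ D) (p d : Fin 4) :
    ricci (sphMetric b F) x p d = gaussCurv b F x * radMetric b F x p d
      + (angCurv F x + radHessTr b F x) * angMetric x p d + 2 * radHess b F x p d := by
  have h1 := h.r_ne x hx
  have h3 := Real.exp_ne_zero (b x)
  simp only [ricci, h.riemannUp_eq hx, Fin.sum_univ_four]
  fin_cases p <;> fin_cases d <;>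
    simp [radProj, angProj, radMetric, angMetric, radHess, radHessUp, radHessTr, grav] <;>
    field_simp <;> ring

theorem scalarCurv_eq (h : SphChart D b F) (hx : x ∈ D) :
    scalarCurv (sphMetric b F) x
      = 2 * gaussCurv b F x + 2 * angCurv F x + 4 * radHessTr b F x := by
  have h1 := h.r_ne x hx
  have h2 := h.sin_ne x hx
  have h3 := Real.exp_ne_zero (b x)
  simp only [scalarCurv, h.ricci_eq hx, h.inv_eq hx, Fin.sum_univ_four]
  simp [sphInv, radMetric, angMetric, radHess, radHessTr, grav]
  field_simp
  ring

/-- In the two-dimensional `(v, r)`-plane the Kulkarni-Nomizu product of a symmetric form with the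
metric is determined by the trace of the form. -/
theorem radHess_kulkarni (h : SphChart D b F) (hx : x ∈ D) (a p c d : Fin 4) :
    radHess b F x a c * radMetric b F x p d + radMetric b F x a c * radHess b F x p d
        - radHess b F x a d * radMetric b F x p c - radMetric b F x a d * radHess b F x p c
      = radHessTr b F x *
        (radMetric b F x a c * radMetric b F x p d - radMetric b F x a d * radMetric b F x p c) := by
  have h1 := h.r_ne x hx
  fin_cases a <;> fin_cases p <;> fin_cases c <;> fin_cases d <;>
    simp [radMetric, radHess, radHessTr, grav] <;> field_simp <;> ring

end SphChart

/-- The algebraic Weyl tensor `h ∧ h + q ∧ q - (h ∧ q) / 2` of a product of two planes with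
metrics `h` and `q`. -/
def weylShape {K : Type} [Field K] (h q : Matrix (Fin 4) (Fin 4) K) (a b c d : Fin 4) : K :=
  (h a c * h b d - h a d * h b c) + (q a c * q b d - q a d * q b c)
    - 1 / 2 * (h a c * q b d + q a c * h b d - h a d * q b c - q a d * h b c)

/-- The scalar factor `α` of the Weyl tensor of `sphMetric`; it equals `-2 Ψ₂`. -/
def weylScalar (b F : Pt → ℝ) (x : Pt) : ℝ :=
  1 / 3 * (gaussCurv b F x + angCurv F x - radHessTr b F x)

namespace SphChart

variable {D : Set Pt} {b F : Pt → ℝ} {x : Pt}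

theorem weyl_eq (h : SphChart D b F) (hx : x ∈ D) (a p c d : Fin 4) :
    weyl (sphMetric b F) x a p c d =
      weylScalar b F x * weylShape (radMetric b F x) (angMetric x) a p c d := by
  have k := h.radHess_kulkarni hx a p c d
  simp only [weyl, h.riemann_eq hx, h.ricci_eq hx, h.scalarCurv_eq hx, weylShape, weylScalar,
    sphMetric_eq_add, Matrix.add_apply]
  linear_combination -k

theorem radial_weylScalar (h : SphChart D b F) : Radial D (weylScalar b F) := by
  have hO := h.isOpen
  have hi : Radial D (fun y => (y 1)⁻¹) := .inv hO .coord_one h.r_ne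
  have hr2 : Radial D (fun y => (y 1 * y 1)⁻¹) :=
    .inv hO (.mul hO .coord_one .coord_one) fun y hy => mul_ne_zero (h.r_ne y hy) (h.r_ne y hy)
  have hE : Radial D (fun y => (Real.exp (b y))⁻¹) :=
    .inv hO (.exp hO h.hb) fun y _ => Real.exp_ne_zero _
  have h1 : Radial D (gaussCurv b F) :=
    .neg hO (.mul hO hE (.add hO ((h.hb.pd hO 0).pd hO 1) (h.radial_grav.pd hO 1)))
  have h2 : Radial D (angCurv F) := .mul hO (.sub hO (.const 1) h.hF) hr2
  have h3 : Radial D (radHessTr b F) :=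
    .neg hO (.mul hO (.add hO (.mul hO (h.hb.pd hO 1) h.hF) (h.hF.pd hO 1)) hi)
  exact .mul hO (.const _) (.sub hO (.add hO h1 h2) h3)

end SphChart

/-! ### The covariant derivative of the Weyl tensor -/

/-- The components of `dr`. -/
def drCov : Fin 4 → ℝ := ![0, 1, 0, 0]

/-- The covariant derivative of `weylShape h q`, up to the factor `1 / r`, when
`∇_e h_{ab} = -∇_e q_{ab} = (u_a q_{be} + u_b q_{ae}) / r`. -/
def covShape {K : Type} [Field K] (h q : Matrix (Fin 4) (Fin 4) K) (u : Fin 4 → K)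
    (a b c d e : Fin 4) : K :=
  3 / 2 * ((u a * q c e + u c * q a e) * (h b d - q b d)
    + (h a c - q a c) * (u b * q d e + u d * q b e)
    - (u a * q d e + u d * q a e) * (h b c - q b c)
    - (h a d - q a d) * (u b * q c e + u c * q b e))

namespace SphChart

variable {D : Set Pt} {b F : Pt → ℝ} {x : Pt}

/-- `∇_e q_{ac} = -(r_{,a} q_{ce} + r_{,c} q_{ae}) / r` for the spherical part `q` of the metric. -/
theorem hasGrad_angMetric (h : SphChart D b F) (hx : x ∈ D) (a c : Fin 4) :
    HasGrad (fun y => angMetric y a c) (fun e =>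
      ∑ f, (gam b F x f e a * angMetric x f c + gam b F x f e c * angMetric x a f)
        - (x 1)⁻¹ * (drCov a * angMetric x c e + drCov c * angMetric x a e)) x := by
  have h1 := h.r_ne x hx
  have h2 := h.sin_ne x hx
  have h3 := Real.exp_ne_zero (b x)
  have gr := HasGrad.coord (x := x) 1
  have gs := HasGrad.sin (x := x) 2
  have g0 := HasGrad.const (x := x) 0
  have g2 := gr.mul gr
  have g3 := (gr.mul gr).mul (gs.mul gs)
  fin_cases a <;> fin_cases c
  all_goals first
    | refine g0.congr_grad fun e => ?_
    | refine g2.congr_grad fun e => ?_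
    | refine g3.congr_grad fun e => ?_
  all_goals clear g0 g2 g3 gr gs
  all_goals fin_cases e <;> simp [Fin.sum_univ_four, gam, angMetric, drCov] <;> field_simp <;>
    first | done | ring1

/-- `∇_e h_{ac} = (r_{,a} q_{ce} + r_{,c} q_{ae}) / r` for the radial part `h` of the metric. -/
theorem hasGrad_radMetric (h : SphChart D b F) (hx : x ∈ D) (a c : Fin 4) :
    HasGrad (fun y => radMetric b F y a c) (fun e =>
      ∑ f, (gam b F x f e a * radMetric b F x f c + gam b F x f e c * radMetric b F x a f)
        + (x 1)⁻¹ * (drCov a * angMetric x c e + drCov c * angMetric x a e)) x := by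
  have h1 := h.r_ne x hx
  have h2 := h.sin_ne x hx
  have h3 := Real.exp_ne_zero (b x)
  have gb := (h.hb.hasGrad h.isOpen hx).exp
  have gF := h.hF.hasGrad h.isOpen hx
  have g0 := HasGrad.const (x := x) 0
  have g00 := ((gb.mul gb).mul gF).neg
  fin_cases a <;> fin_cases c
  all_goals first
    | refine g00.congr_grad fun e => ?_
    | refine g0.congr_grad fun e => ?_
    | refine gb.congr_grad fun e => ?_
  all_goals clear g0 g00 gb gF
  all_goals fin_cases e <;>
    simp [Fin.sum_univ_four, gam, radMetric, angMetric, drCov, accel, grav] <;> field_simp <;>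
    first | done | ring1

/-- `∇C = dα ⊗ K + (α / r) M`. The Christoffel symbols enter through the gradients of `h` and `q` only,
so this is the Leibniz rule. -/
theorem covWeyl_eq (h : SphChart D b F) (hx : x ∈ D) (a p c d e : Fin 4) :
    covWeyl (sphMetric b F) x a p c d e =
      pd e (weylScalar b F) x * weylShape (radMetric b F x) (angMetric x) a p c d
      + weylScalar b F x * (x 1)⁻¹ *
        covShape (radMetric b F x) (angMetric x) drCov a p c d e := by
  have hh := h.hasGrad_radMetric hx
  have hq := h.hasGrad_angMetric hx
  have hw := HasGrad.of_differentiableAt (h.radial_weylScalar.differentiableAt h.isOpen hx)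
  have hK := hw.mul (((((hh a c).mul (hh p d)).sub ((hh a d).mul (hh p c))).add
    (((hq a c).mul (hq p d)).sub ((hq a d).mul (hq p c)))).sub
    ((HasGrad.const (1 / 2)).mul (((((hh a c).mul (hq p d)).add ((hq a c).mul (hh p d))).sub
      ((hh a d).mul (hq p c))).sub ((hq a d).mul (hh p c)))))
  have e1 : pd e (fun y => weyl (sphMetric b F) y a p c d) x = _ :=
    (pd_congr h.isOpen hx (fun y hy => h.weyl_eq hy a p c d) e).trans (hK.2 e)
  simp only [covWeyl, h.christoffel_eq hx, h.weyl_eq hx]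
  rw [e1]
  clear e1 hK hw
  simp only [weylShape, covShape, Fin.sum_univ_four, Pi.zero_apply]
  ring

end SphChart

/-! ### Contractions in arbitrary frames -/

/-- Covariant tensors of some fixed rank with components in `K`: a change of frame acts on them
by matrices, the plain sum of products of components is a pairing, and the transposed matrix acts as
the adjoint. -/
structure FrameAction (K M : Type) [CommRing K] [AddCommGroup M] [Module K M] where
  act : Matrix (Fin 4) (Fin 4) K → M →ₗ[K] M
  pair : M →ₗ[K] M →ₗ[K] K
  act_mul : ∀ A B t, act A (act B t) = act (A * B) t
  pair_act : ∀ A s t, pair (act A s) t = pair s (act A.transpose t)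

namespace FrameAction

variable {K M : Type} [CommRing K] [AddCommGroup M] [Module K M]

/-- Scalars. -/
def scalar (K : Type) [CommRing K] : FrameAction K K where
  act _ := LinearMap.id
  pair := LinearMap.mul K K
  act_mul _ _ _ := rfl
  pair_act _ _ _ := rfl

/-- Tensors of one rank more; the new index comes first. -/
def succ (Φ : FrameAction K M) : FrameAction K (Fin 4 → M) where
  act A := LinearMap.pi fun i => ∑ a, A i a • (Φ.act A).comp (LinearMap.proj a)
  pair := ∑ a, Φ.pair.compl₁₂ (LinearMap.proj a) (LinearMap.proj a)
  act_mul A B t := by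
    ext i
    simp only [LinearMap.pi_apply, LinearMap.sum_apply, LinearMap.smul_apply, LinearMap.comp_apply,
      LinearMap.proj_apply, map_sum, map_smul, Φ.act_mul, Matrix.mul_apply, Finset.sum_smul,
      Finset.smul_sum, smul_smul]
    exact Finset.sum_comm
  pair_act A s t := by
    simp only [LinearMap.sum_apply, LinearMap.compl₁₂_apply, LinearMap.proj_apply,
      LinearMap.pi_apply, LinearMap.smul_apply, LinearMap.comp_apply, map_sum, map_smul,
      Φ.pair_act, Matrix.transpose_apply]
    exact Finset.sum_comm

theorem succ_act_apply (Φ : FrameAction K M) (A : Matrix (Fin 4) (Fin 4) K) (t : Fin 4 → M)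
    (i : Fin 4) : Φ.succ.act A t i = ∑ a, A i a • Φ.act A (t a) := by
  simp [succ]

theorem succ_pair_apply (Φ : FrameAction K M) (s t : Fin 4 → M) :
    Φ.succ.pair s t = ∑ a, Φ.pair (s a) (t a) := by
  simp [succ]

/-- The contraction of a tensor with itself does not depend on the frame. -/
theorem pair_act_invariant (Φ : FrameAction K M) {E h h' : Matrix (Fin 4) (Fin 4) K}
    (hE : E.transpose * h' * E = h) (t : M) :
    Φ.pair (Φ.act E t) (Φ.act h' (Φ.act E t)) = Φ.pair t (Φ.act h t) := by
  rw [Φ.pair_act, Φ.act_mul, Φ.act_mul, hE]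

end FrameAction

open FrameAction

/-- A contraction is the pairing of a tensor with the tensor that has all indices raised, and raising
indices by `h` is the action of the matrix `h`. -/
theorem normSq1_eq {K : Type} [CommRing K] (h : Matrix (Fin 4) (Fin 4) K) (T : Fin 4 → K) :
    normSq1 h T = (scalar K).succ.pair T ((scalar K).succ.act h T) := by
  simp only [normSq1, succ_pair_apply, succ_act_apply, scalar, LinearMap.mul_apply',
    Finset.mul_sum, smul_eq_mul, LinearMap.id_apply]
  refine Finset.sum_congr rfl fun _ _ => Finset.sum_congr rfl fun _ _ => by ring

theorem normSq4_eq {K : Type} [CommRing K] (h : Matrix (Fin 4) (Fin 4) K)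
    (T : Fin 4 → Fin 4 → Fin 4 → Fin 4 → K) :
    normSq4 h T = (scalar K).succ.succ.succ.succ.pair T
      ((scalar K).succ.succ.succ.succ.act h T) := by
  simp only [normSq4, succ_pair_apply, succ_act_apply, scalar, LinearMap.mul_apply',
    Finset.mul_sum, smul_eq_mul, LinearMap.id_apply, Finset.sum_apply, Pi.smul_apply]
  repeat refine Finset.sum_congr rfl fun _ _ => ?_
  ring

theorem normSq5_eq {K : Type} [CommRing K] (h : Matrix (Fin 4) (Fin 4) K)
    (T : Fin 4 → Fin 4 → Fin 4 → Fin 4 → Fin 4 → K) :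
    normSq5 h T = (scalar K).succ.succ.succ.succ.succ.pair T
      ((scalar K).succ.succ.succ.succ.succ.act h T) := by
  simp only [normSq5, succ_pair_apply, succ_act_apply, scalar, LinearMap.mul_apply',
    Finset.mul_sum, smul_eq_mul, LinearMap.id_apply, Finset.sum_apply, Pi.smul_apply]
  repeat refine Finset.sum_congr rfl fun _ _ => ?_
  ring

theorem comp1_eq (E : Matrix (Fin 4) (Fin 4) ℂ) (T : Fin 4 → ℝ) :
    comp1 E T = (scalar ℂ).succ.act E (fun a => (T a : ℂ)) := by
  ext i
  simp only [comp1, succ_act_apply, scalar, smul_eq_mul, LinearMap.id_apply]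

theorem comp4_eq (E : Matrix (Fin 4) (Fin 4) ℂ) (T : Fin 4 → Fin 4 → Fin 4 → Fin 4 → ℝ) :
    comp4 E T = (scalar ℂ).succ.succ.succ.succ.act E (fun a b c d => (T a b c d : ℂ)) := by
  ext i j k l
  simp only [comp4, succ_act_apply, scalar, smul_eq_mul, LinearMap.id_apply, Finset.sum_apply,
    Pi.smul_apply, Finset.mul_sum, mul_assoc]

theorem comp5_eq (E : Matrix (Fin 4) (Fin 4) ℂ)
    (T : Fin 4 → Fin 4 → Fin 4 → Fin 4 → Fin 4 → ℝ) :
    comp5 E T = (scalar ℂ).succ.succ.succ.succ.succ.act E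
      (fun a b c d e => (T a b c d e : ℂ)) := by
  ext i j k l n
  simp only [comp5, succ_act_apply, scalar, smul_eq_mul, LinearMap.id_apply, Finset.sum_apply,
    Pi.smul_apply, Finset.mul_sum, mul_assoc]

theorem inv_map_ofReal (A : Matrix (Fin 4) (Fin 4) ℝ) (hA : IsUnit A.det) :
    (A.map (fun t : ℝ => (t : ℂ)))⁻¹ = A⁻¹.map (fun t : ℝ => (t : ℂ)) := by
  apply Matrix.inv_eq_right_inv
  have h := congrArg (fun B : Matrix (Fin 4) (Fin 4) ℝ => B.map Complex.ofRealHom)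
    (Matrix.mul_nonsing_inv A hA)
  rw [Matrix.map_mul, Matrix.map_one _ (map_zero _) (map_one _)] at h
  exact h

/-- The inverse metric transforms contragrediently to covariant tensors. -/
theorem frameMetric_inv (g : Metric) (x : Pt) (E : Matrix (Fin 4) (Fin 4) ℂ)
    (hg : IsUnit (g x).det) (hE : IsUnit E.det) :
    E.transpose * (frameMetric g x E)⁻¹ * E = (g x)⁻¹.map (fun t : ℝ => (t : ℂ)) := by
  have hE' : IsUnit E.transpose.det := by rwa [Matrix.det_transpose]
  rw [frameMetric, Matrix.mul_inv_rev, Matrix.mul_inv_rev, inv_map_ofReal _ hg,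
    ← Matrix.mul_assoc, Matrix.mul_nonsing_inv _ hE', Matrix.one_mul, Matrix.mul_assoc,
    Matrix.nonsing_inv_mul _ hE, Matrix.mul_one]

theorem normSq1_ofReal (h : Matrix (Fin 4) (Fin 4) ℝ) (T : Fin 4 → ℝ) :
    normSq1 (h.map (fun t : ℝ => (t : ℂ))) (fun a => (T a : ℂ)) = ((normSq1 h T : ℝ) : ℂ) := by
  simp only [normSq1, Matrix.map_apply, Complex.ofReal_sum, Complex.ofReal_mul]

theorem normSq4_ofReal (h : Matrix (Fin 4) (Fin 4) ℝ) (T : Fin 4 → Fin 4 → Fin 4 → Fin 4 → ℝ) :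
    normSq4 (h.map (fun t : ℝ => (t : ℂ))) (fun a b c d => (T a b c d : ℂ))
      = ((normSq4 h T : ℝ) : ℂ) := by
  simp only [normSq4, Matrix.map_apply, Complex.ofReal_sum, Complex.ofReal_mul]

theorem normSq5_ofReal (h : Matrix (Fin 4) (Fin 4) ℝ)
    (T : Fin 4 → Fin 4 → Fin 4 → Fin 4 → Fin 4 → ℝ) :
    normSq5 (h.map (fun t : ℝ => (t : ℂ))) (fun a b c d e => (T a b c d e : ℂ))
      = ((normSq5 h T : ℝ) : ℂ) := by
  rw [normSq5, normSq5]
  -- one step for each of the ten indices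
  iterate 10
    rw [Complex.ofReal_sum]
    refine Finset.sum_congr rfl fun _ _ => ?_
  simp only [Matrix.map_apply, Complex.ofReal_mul]

theorem normSq1_comp1 (g : Metric) (x : Pt) (E : Matrix (Fin 4) (Fin 4) ℂ)
    (hg : IsUnit (g x).det) (hE : IsUnit E.det)
    (T : Fin 4 → ℝ) :
    normSq1 (frameMetric g x E)⁻¹ (comp1 E T) = ((normSq1 (g x)⁻¹ T : ℝ) : ℂ) := by
  rw [normSq1_eq, comp1_eq, pair_act_invariant _ (frameMetric_inv g x E hg hE), ← normSq1_eq,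
    normSq1_ofReal]

theorem normSq4_comp4 (g : Metric) (x : Pt) (E : Matrix (Fin 4) (Fin 4) ℂ)
    (hg : IsUnit (g x).det) (hE : IsUnit E.det)
    (T : Fin 4 → Fin 4 → Fin 4 → Fin 4 → ℝ) :
    normSq4 (frameMetric g x E)⁻¹ (comp4 E T) = ((normSq4 (g x)⁻¹ T : ℝ) : ℂ) := by
  rw [normSq4_eq, comp4_eq, pair_act_invariant _ (frameMetric_inv g x E hg hE), ← normSq4_eq,
    normSq4_ofReal]

theorem normSq5_comp5 (g : Metric) (x : Pt) (E : Matrix (Fin 4) (Fin 4) ℂ)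
    (hg : IsUnit (g x).det) (hE : IsUnit E.det)
    (T : Fin 4 → Fin 4 → Fin 4 → Fin 4 → Fin 4 → ℝ) :
    normSq5 (frameMetric g x E)⁻¹ (comp5 E T) = ((normSq5 (g x)⁻¹ T : ℝ) : ℂ) := by
  rw [normSq5_eq, comp5_eq, pair_act_invariant _ (frameMetric_inv g x E hg hE), ← normSq5_eq,
    normSq5_ofReal]

theorem frameSpi_eq (g : Metric) (x : Pt) (E : Matrix (Fin 4) (Fin 4) ℂ)
    (hg : IsUnit (g x).det) (hE : IsUnit E.det) :
    frameSpi g x E = (spi g x : ℂ) := by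
  rw [frameSpi, normSq1_comp1 g x E hg hE, normSq4_comp4 g x E hg hE, normSq5_comp5 g x E hg hE]
  simp only [spi, I1, I3, I5, Complex.ofReal_sub, Complex.ofReal_mul, Complex.ofReal_ofNat]

/-! ### Components in a null tetrad -/

open FrameAction

/-- The components `∑ E_i^a E_j^b h_{ab}` of a bilinear form in the frame `E`. -/
def frameForm (E : Matrix (Fin 4) (Fin 4) ℂ) (h : Matrix (Fin 4) (Fin 4) ℝ) :
    Matrix (Fin 4) (Fin 4) ℂ :=
  Matrix.of fun i j => ∑ a, E i a * ∑ b, E j b * (h a b : ℂ)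

theorem frameMetric_eq_frameForm (g : Metric) (x : Pt) (E : Matrix (Fin 4) (Fin 4) ℂ) :
    frameMetric g x E = frameForm E (g x) := by
  ext i j
  simp only [frameMetric, frameForm, Matrix.of_apply, Matrix.mul_apply, Matrix.map_apply,
    Matrix.transpose_apply, Fin.sum_univ_four]
  ring

/-- `weylShape` as a function of the entries of `h` and `q`. -/
def weylPoly (hac had hbc hbd qac qad qbc qbd : ℂ) : ℂ :=
  (hac * hbd - had * hbc) + (qac * qbd - qad * qbc)
    - 1 / 2 * (hac * qbd + qac * hbd - had * qbc - qad * hbc)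

/-- `covShape` as a function of the components of `u`, `q` and of `t = h - q`. -/
def covPoly (ua ub uc ud qae qbe qce qde tac tad tbc tbd : ℂ) : ℂ :=
  3 / 2 * ((ua * qce + uc * qae) * tbd + tac * (ub * qde + ud * qbe)
    - (ua * qde + ud * qae) * tbc - tad * (ub * qce + uc * qbe))

/-- `weylPoly` is linear in the entries that carry a given index, so the frame components are computed
one index at a time. -/
theorem comp4_weylShape (E : Matrix (Fin 4) (Fin 4) ℂ) (h q : Matrix (Fin 4) (Fin 4) ℝ)
    (i j k l : Fin 4) :
    comp4 E (weylShape h q) i j k l = weylShape (frameForm E h) (frameForm E q) i j k l := by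
  have e4 : ∀ (w f1 f2 f3 f4 : Fin 4 → ℂ) (x1 x2 x3 x4 : ℂ),
      ∑ d, w d * weylPoly x1 (f1 d) x2 (f2 d) x3 (f3 d) x4 (f4 d)
      = weylPoly x1 (∑ d, w d * f1 d) x2 (∑ d, w d * f2 d) x3 (∑ d, w d * f3 d) x4
        (∑ d, w d * f4 d) := by
    intros; simp only [weylPoly, Fin.sum_univ_four]; ring
  have e3 : ∀ (w f1 f2 f3 f4 : Fin 4 → ℂ) (x1 x2 x3 x4 : ℂ),
      ∑ c, w c * weylPoly (f1 c) x1 (f2 c) x2 (f3 c) x3 (f4 c) x4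
      = weylPoly (∑ c, w c * f1 c) x1 (∑ c, w c * f2 c) x2 (∑ c, w c * f3 c) x3
        (∑ c, w c * f4 c) x4 := by
    intros; simp only [weylPoly, Fin.sum_univ_four]; ring
  have e2 : ∀ (w f1 f2 f3 f4 : Fin 4 → ℂ) (x1 x2 x3 x4 : ℂ),
      ∑ b, w b * weylPoly x1 x2 (f1 b) (f2 b) x3 x4 (f3 b) (f4 b)
      = weylPoly x1 x2 (∑ b, w b * f1 b) (∑ b, w b * f2 b) x3 x4 (∑ b, w b * f3 b)
        (∑ b, w b * f4 b) := by
    intros; simp only [weylPoly, Fin.sum_univ_four]; ring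
  have e1 : ∀ (w f1 f2 f3 f4 : Fin 4 → ℂ) (x1 x2 x3 x4 : ℂ),
      ∑ a, w a * weylPoly (f1 a) (f2 a) x1 x2 (f3 a) (f4 a) x3 x4
      = weylPoly (∑ a, w a * f1 a) (∑ a, w a * f2 a) x1 x2 (∑ a, w a * f3 a)
        (∑ a, w a * f4 a) x3 x4 := by
    intros; simp only [weylPoly, Fin.sum_univ_four]; ring
  have e0 : ∀ a b c d, ((weylShape h q a b c d : ℝ) : ℂ) = weylPoly (h a c) (h a d) (h b c) (h b d)
      (q a c) (q a d) (q b c) (q b d) := by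
    intros; simp only [weylShape, weylPoly]; push_cast; ring
  rw [comp4_eq]
  simp only [succ_act_apply, scalar, smul_eq_mul, LinearMap.id_apply, Finset.sum_apply,
    Pi.smul_apply]
  simp only [e0, e4, e3, e2, e1]
  rfl

/-- As for `comp4_weylShape`, one index at a time. -/
theorem comp5_covShape (E : Matrix (Fin 4) (Fin 4) ℂ) (h q : Matrix (Fin 4) (Fin 4) ℝ)
    (u : Fin 4 → ℝ) (i j k l n : Fin 4) :
    comp5 E (covShape h q u) i j k l n
      = covShape (frameForm E h) (frameForm E q) (comp1 E u) i j k l n := by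
  have e5 : ∀ (w f1 f2 f3 f4 : Fin 4 → ℂ) (x1 x2 x3 x4 y1 y2 y3 y4 : ℂ),
      ∑ e, w e * covPoly x1 x2 x3 x4 (f1 e) (f2 e) (f3 e) (f4 e) y1 y2 y3 y4
      = covPoly x1 x2 x3 x4 (∑ e, w e * f1 e) (∑ e, w e * f2 e) (∑ e, w e * f3 e)
        (∑ e, w e * f4 e) y1 y2 y3 y4 := by
    intros; simp only [covPoly, Fin.sum_univ_four]; ring
  have e4 : ∀ (w f1 f2 f3 f4 : Fin 4 → ℂ) (x1 x2 x3 y1 y2 y3 z1 z2 : ℂ),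
      ∑ d, w d * covPoly x1 x2 x3 (f1 d) y1 y2 y3 (f2 d) z1 (f3 d) z2 (f4 d)
      = covPoly x1 x2 x3 (∑ d, w d * f1 d) y1 y2 y3 (∑ d, w d * f2 d) z1 (∑ d, w d * f3 d) z2
        (∑ d, w d * f4 d) := by
    intros; simp only [covPoly, Fin.sum_univ_four]; ring
  have e3 : ∀ (w f1 f2 f3 f4 : Fin 4 → ℂ) (x1 x2 x3 y1 y2 y3 z1 z2 : ℂ),
      ∑ c, w c * covPoly x1 x2 (f1 c) x3 y1 y2 (f2 c) y3 (f3 c) z1 (f4 c) z2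
      = covPoly x1 x2 (∑ c, w c * f1 c) x3 y1 y2 (∑ c, w c * f2 c) y3 (∑ c, w c * f3 c) z1
        (∑ c, w c * f4 c) z2 := by
    intros; simp only [covPoly, Fin.sum_univ_four]; ring
  have e2 : ∀ (w f1 f2 f3 f4 : Fin 4 → ℂ) (x1 x2 x3 y1 y2 y3 z1 z2 : ℂ),
      ∑ b, w b * covPoly x1 (f1 b) x2 x3 y1 (f2 b) y2 y3 z1 z2 (f3 b) (f4 b)
      = covPoly x1 (∑ b, w b * f1 b) x2 x3 y1 (∑ b, w b * f2 b) y2 y3 z1 z2 (∑ b, w b * f3 b)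
        (∑ b, w b * f4 b) := by
    intros; simp only [covPoly, Fin.sum_univ_four]; ring
  have e1 : ∀ (w f1 f2 f3 f4 : Fin 4 → ℂ) (x1 x2 x3 y1 y2 y3 z1 z2 : ℂ),
      ∑ a, w a * covPoly (f1 a) x1 x2 x3 (f2 a) y1 y2 y3 (f3 a) (f4 a) z1 z2
      = covPoly (∑ a, w a * f1 a) x1 x2 x3 (∑ a, w a * f2 a) y1 y2 y3 (∑ a, w a * f3 a)
        (∑ a, w a * f4 a) z1 z2 := by
    intros; simp only [covPoly, Fin.sum_univ_four]; ring
  have e0 : ∀ a b c d e, ((covShape h q u a b c d e : ℝ) : ℂ) = covPoly (u a) (u b) (u c) (u d)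
      (q a e) (q b e) (q c e) (q d e) (h a c - q a c) (h a d - q a d) (h b c - q b c)
      (h b d - q b d) := by
    intros; simp only [covShape, covPoly]; push_cast; ring
  rw [comp5_eq]
  simp only [succ_act_apply, scalar, smul_eq_mul, LinearMap.id_apply, Finset.sum_apply,
    Pi.smul_apply]
  simp only [e0, e5, e4, e3, e2, e1]
  simp only [mul_sub, Finset.sum_sub_distrib]
  rfl

/-- The matrix of the metric in a null tetrad, `ℓ · n = -1` and `m · m̄ = 1`. -/
def nullForm : Matrix (Fin 4) (Fin 4) ℂ := !![0, -1, 0, 0; -1, 0, 0, 0; 0, 0, 0, 1; 0, 0, 1, 0]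

/-- The part of `nullForm` spanned by `ℓ` and `n`. -/
def nullRad : Matrix (Fin 4) (Fin 4) ℂ := !![0, -1, 0, 0; -1, 0, 0, 0; 0, 0, 0, 0; 0, 0, 0, 0]

/-- The part of `nullForm` spanned by `m` and `m̄`. -/
def nullAng : Matrix (Fin 4) (Fin 4) ℂ := !![0, 0, 0, 0; 0, 0, 0, 0; 0, 0, 0, 1; 0, 0, 1, 0]

theorem nullForm_inv : nullForm⁻¹ = nullForm := by
  apply Matrix.inv_eq_right_inv
  ext i j
  fin_cases i <;> fin_cases j <;> simp [nullForm, Matrix.mul_apply, Fin.sum_univ_four]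

/-- The vector dual to the `a`-th vector of a null tetrad is, up to the sign `dualSign a`, the vector
with number `dualIdx a`. -/
def dualIdx : Fin 4 → Fin 4 := ![1, 0, 3, 2]

/-- See `dualIdx`. -/
def dualSign : Fin 4 → ℂ := ![-1, -1, 1, 1]

theorem sum_nullForm (a : Fin 4) (f : Fin 4 → ℂ) :
    ∑ b, nullForm a b * f b = dualSign a * f (dualIdx a) := by
  fin_cases a <;> simp [nullForm, Fin.sum_univ_four, dualSign, dualIdx]

/-- The contraction of two tensors of rank four in a null tetrad. -/
def nullPair4 (S T : Fin 4 → Fin 4 → Fin 4 → Fin 4 → ℂ) : ℂ :=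
  ∑ a, ∑ b, ∑ c, ∑ d, S a b c d * (dualSign a * (dualSign b * (dualSign c * (dualSign d *
    T (dualIdx a) (dualIdx b) (dualIdx c) (dualIdx d)))))

theorem normSq4_nullForm (T : Fin 4 → Fin 4 → Fin 4 → Fin 4 → ℂ) :
    normSq4 nullForm T = nullPair4 T T := by
  rw [normSq4_eq]
  simp only [nullPair4, succ_pair_apply, succ_act_apply, scalar, LinearMap.mul_apply',
    smul_eq_mul, LinearMap.id_apply, Finset.sum_apply, Pi.smul_apply, sum_nullForm]

theorem normSq5_nullForm (T : Fin 4 → Fin 4 → Fin 4 → Fin 4 → Fin 4 → ℂ) :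
    normSq5 nullForm T = -nullPair4 (fun a b c d => T a b c d 0) (fun a b c d => T a b c d 1)
      - nullPair4 (fun a b c d => T a b c d 1) (fun a b c d => T a b c d 0)
      + nullPair4 (fun a b c d => T a b c d 2) (fun a b c d => T a b c d 3)
      + nullPair4 (fun a b c d => T a b c d 3) (fun a b c d => T a b c d 2) := by
  rw [normSq5_eq]
  simp only [nullPair4, succ_pair_apply, succ_act_apply, scalar, LinearMap.mul_apply',
    smul_eq_mul, LinearMap.id_apply, Finset.sum_apply, Pi.smul_apply, sum_nullForm,
    ← Finset.sum_neg_distrib, ← Finset.sum_sub_distrib, ← Finset.sum_add_distrib]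
  refine Finset.sum_congr rfl fun a _ => Finset.sum_congr rfl fun b _ =>
    Finset.sum_congr rfl fun c _ => Finset.sum_congr rfl fun d _ => ?_
  rw [Fin.sum_univ_four]
  simp [dualSign, dualIdx]
  ring

theorem nullPair4_smul (s t : ℂ) (S T : Fin 4 → Fin 4 → Fin 4 → Fin 4 → ℂ) :
    nullPair4 (fun a b c d => s * S a b c d) (fun a b c d => t * T a b c d)
      = s * t * nullPair4 S T := by
  simp only [nullPair4, Finset.mul_sum]
  refine Finset.sum_congr rfl fun a _ => Finset.sum_congr rfl fun b _ =>
    Finset.sum_congr rfl fun c _ => Finset.sum_congr rfl fun d _ => ?_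
  ring

theorem nullPair4_comm (S T : Fin 4 → Fin 4 → Fin 4 → Fin 4 → ℂ) :
    nullPair4 S T = nullPair4 T S := by
  have h : Function.Involutive dualIdx := by
    intro a; fin_cases a <;> rfl
  have hs : ∀ a, dualSign (dualIdx a) = dualSign a := by
    intro a; fin_cases a <;> rfl
  let e := h.toPerm
  simp only [nullPair4]
  rw [← Equiv.sum_comp e]
  refine Finset.sum_congr rfl fun a _ => ?_
  rw [← Equiv.sum_comp e]
  refine Finset.sum_congr rfl fun b _ => ?_
  rw [← Equiv.sum_comp e]
  refine Finset.sum_congr rfl fun c _ => ?_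
  rw [← Equiv.sum_comp e]
  refine Finset.sum_congr rfl fun d _ => ?_
  simp only [e, Function.Involutive.coe_toPerm, hs, h _]
  ring

set_option maxHeartbeats 2000000 in
/-- `K_{abcd} K^{abcd} = 12`. -/
theorem nullPair4_weylShape :
    nullPair4 (weylShape nullRad nullAng) (weylShape nullRad nullAng) = 12 := by
  simp only [nullPair4, Fin.sum_univ_four]
  simp [weylShape, nullRad, nullAng, dualSign, dualIdx]
  norm_num

/-- `M_{abcde}` is proportional to the spherical metric in the index `e`. -/
theorem covShape_null_of_radial {u : Fin 4 → ℂ} (e : Fin 4) (he : e = 0 ∨ e = 1)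
    (a b c d : Fin 4) : covShape nullRad nullAng u a b c d e = 0 := by
  have h : ∀ i, nullAng i e = 0 := by
    rcases he with rfl | rfl <;> intro i <;> fin_cases i <;> simp [nullAng]
  simp [covShape, h]

set_option maxHeartbeats 4000000 in
/-- The contraction of `M` along the two null directions of the sphere; `u` has the components `s`, `t`
along `ℓ`, `n`. -/
theorem nullPair4_covShape (s t : ℂ) :
    nullPair4 (fun a b c d => covShape nullRad nullAng ![s, t, 0, 0] a b c d 2)
      (fun a b c d => covShape nullRad nullAng ![s, t, 0, 0] a b c d 3) = -72 * (s * t) := by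
  simp only [nullPair4, Fin.sum_univ_four]
  simp [covShape, nullRad, nullAng, dualSign, dualIdx]
  ring

/-! ### The tetrad of the imploding metric -/

theorem isOpen_chartDomain {U : Set (ℝ × ℝ)} (hU : IsOpen U) : IsOpen (chartDomain U) := by
  have h1 : Continuous fun x : Pt => (x 0, x 1) := by fun_prop
  exact (hU.preimage h1).inter ((isOpen_lt continuous_const (continuous_apply 2)).inter
    (isOpen_lt (continuous_apply 2) continuous_const))

theorem radial_comp {U : Set (ℝ × ℝ)} (hU : IsOpen U) {f : ℝ → ℝ → ℝ}
    (hf : ContDiffOn ℝ ∞ (fun p : ℝ × ℝ => f p.1 p.2) U) :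
    Radial (chartDomain U) (fun x => f (x 0) (x 1)) := by
  have hπ : ContDiff ℝ ∞ fun x : Pt => (x 0, x 1) :=
    (contDiff_apply ℝ ℝ (0 : Fin 4)).prodMk (contDiff_apply ℝ ℝ (1 : Fin 4))
  have hs : ContDiffOn ℝ ∞ (fun x : Pt => f (x 0) (x 1)) (chartDomain U) :=
    hf.comp (g := fun p : ℝ × ℝ => f p.1 p.2) hπ.contDiffOn fun x hx => hx.1
  have key : ∀ i : Fin 4, i ≠ 0 → i ≠ 1 → ∀ x ∈ chartDomain U,
      pd i (fun x => f (x 0) (x 1)) x = 0 := by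
    intro i h0 h1 x hx
    have hd : DifferentiableAt ℝ (fun x : Pt => f (x 0) (x 1)) x :=
      (hs.contDiffAt ((isOpen_chartDomain hU).mem_nhds hx)).differentiableAt (by simp)
    -- moving along `θ` or `φ` does not change `v` and `r`
    rw [pd, ← hd.lineDeriv_eq_fderiv, lineDeriv]
    simp [h0.symm, h1.symm]
  exact ⟨hs, key 2 (by decide) (by decide), key 3 (by decide) (by decide)⟩

/-- The function `β` on the spacetime. -/
def betaFun (β : ℝ → ℝ → ℝ) (x : Pt) : ℝ := β (x 0) (x 1)

/-- The function `1 - 2m/r = g^{rr}` on the spacetime. -/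
def lapse (m : ℝ → ℝ → ℝ) (x : Pt) : ℝ := 1 - 2 * m (x 0) (x 1) * (x 1)⁻¹

theorem implodingMetric_eq (β m : ℝ → ℝ → ℝ) :
    implodingMetric β m = sphMetric (betaFun β) (lapse m) := by
  ext x i j
  rw [implodingMetric, two_mul (β (x 0) (x 1)), Real.exp_add, div_eq_mul_inv,
    ← pow_two (Real.exp (β (x 0) (x 1)))]
  rfl

theorem sphChart {U : Set (ℝ × ℝ)} (hU : IsOpen U) (hr : ∀ p ∈ U, 0 < p.2) {β m : ℝ → ℝ → ℝ}
    (hβ : ContDiffOn ℝ ∞ (fun p : ℝ × ℝ => β p.1 p.2) U)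
    (hm : ContDiffOn ℝ ∞ (fun p : ℝ × ℝ => m p.1 p.2) U) :
    SphChart (chartDomain U) (betaFun β) (lapse m) := by
  have hO := isOpen_chartDomain hU
  have h1 : ∀ x ∈ chartDomain U, x 1 ≠ 0 := fun x hx => (hr _ hx.1).ne'
  refine ⟨hO, h1, fun x hx => (Real.sin_pos_of_pos_of_lt_pi hx.2.1 hx.2.2).ne',
    radial_comp hU hβ, ?_⟩
  exact .sub hO (.const 1) (.mul hO (.mul hO (.const 2) (radial_comp hU hm))
    (.inv hO .coord_one h1))

section Tetrad

variable {β m : ℝ → ℝ → ℝ} {x : Pt}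

theorem frameForm_radMetric :
    frameForm (tetrad β m x) (radMetric (betaFun β) (lapse m) x) = nullRad := by
  have h3 : ((Real.exp (β (x 0) (x 1)) : ℝ) : ℂ) ≠ 0 :=
    Complex.ofReal_ne_zero.2 (Real.exp_ne_zero _)
  ext i j
  simp only [frameForm, Matrix.of_apply, Fin.sum_univ_four]
  fin_cases i <;> fin_cases j <;>
    simp [tetrad, ell, enn, emm, radMetric, nullRad, betaFun, lapse, Real.exp_neg, div_eq_mul_inv,
      -Complex.ofReal_exp] <;> field_simp <;> ring

theorem frameForm_angMetric (h1 : x 1 ≠ 0) (h2 : Real.sin (x 2) ≠ 0) :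
    frameForm (tetrad β m x) (angMetric x) = nullAng := by
  have h1' : ((x 1 : ℝ) : ℂ) ≠ 0 := Complex.ofReal_ne_zero.2 h1
  have h2' : ((Real.sin (x 2) : ℝ) : ℂ) ≠ 0 := Complex.ofReal_ne_zero.2 h2
  have h4 : ((Real.sqrt 2 : ℝ) : ℂ) ^ 2 = 2 := by
    rw [← Complex.ofReal_pow, Real.sq_sqrt (by norm_num)]; norm_num
  have h5 : ((Real.sqrt 2 : ℝ) : ℂ) ≠ 0 := Complex.ofReal_ne_zero.2 (by positivity)
  ext i j
  simp only [frameForm, Matrix.of_apply, Fin.sum_univ_four]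
  fin_cases i <;> fin_cases j <;>
    simp [tetrad, ell, enn, emm, angMetric, nullAng, -Complex.ofReal_sin] <;> field_simp <;>
    simp [h4, Complex.I_sq] <;> norm_num

/-- A covector annihilating the spheres has components only along `ℓ` and `n`. -/
theorem comp1_tetrad (T : Fin 4 → ℝ) (h2 : T 2 = 0) (h3 : T 3 = 0) :
    comp1 (tetrad β m x) T =
      ![((T 0 + 1 / 2 * Real.exp (betaFun β x) * lapse m x * T 1 : ℝ) : ℂ),
        ((-((Real.exp (betaFun β x))⁻¹ * T 1) : ℝ) : ℂ), 0, 0] := by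
  ext i
  simp only [comp1, Fin.sum_univ_four, h2, h3]
  fin_cases i <;>
    simp [tetrad, ell, enn, emm, betaFun, lapse, Real.exp_neg, div_eq_mul_inv]

end Tetrad

theorem comp4_smul (E : Matrix (Fin 4) (Fin 4) ℂ) (s : ℝ) (T : Fin 4 → Fin 4 → Fin 4 → Fin 4 → ℝ)
    (i j k l : Fin 4) :
    comp4 E (fun a b c d => s * T a b c d) i j k l = s * comp4 E T i j k l := by
  simp only [comp4, Finset.mul_sum, Complex.ofReal_mul]
  repeat refine Finset.sum_congr rfl fun _ _ => ?_
  ring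

theorem comp5_mul_add (E : Matrix (Fin 4) (Fin 4) ℂ) (s : ℝ) (D : Fin 4 → ℝ)
    (S : Fin 4 → Fin 4 → Fin 4 → Fin 4 → ℝ) (T : Fin 4 → Fin 4 → Fin 4 → Fin 4 → Fin 4 → ℝ)
    (i j k l n : Fin 4) :
    comp5 E (fun a b c d e => D e * S a b c d + s * T a b c d e) i j k l n
      = comp1 E D n * comp4 E S i j k l + s * comp5 E T i j k l n := by
  have h : comp1 E D n * comp4 E S i j k l = ∑ a, ∑ b, ∑ c, ∑ d, ∑ e,
      E i a * E j b * E k c * E l d * E n e * ((D e : ℂ) * (S a b c d : ℂ)) := by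
    rw [mul_comm]
    simp only [comp4, Finset.sum_mul]
    simp only [comp1, Finset.mul_sum]
    repeat refine Finset.sum_congr rfl fun _ _ => ?_
    ring
  rw [h]
  simp only [comp5, Finset.mul_sum, ← Finset.sum_add_distrib]
  repeat refine Finset.sum_congr rfl fun _ _ => ?_
  push_cast
  ring

section Invariants

variable {U : Set (ℝ × ℝ)} {β m : ℝ → ℝ → ℝ} {x : Pt}

theorem SphChart.isUnit_det {D : Set Pt} {b F : Pt → ℝ} (h : SphChart D b F) (hx : x ∈ D) :
    IsUnit (sphMetric b F x).det := by
  have h1 := h.r_ne x hx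
  have h2 := h.sin_ne x hx
  have h3 := Real.exp_ne_zero (b x)
  have hI : sphMetric b F x * sphInv b F x = 1 := by
    ext i j
    fin_cases i <;> fin_cases j <;>
      simp [sphMetric, sphInv, Matrix.mul_apply, Fin.sum_univ_four] <;> field_simp
    all_goals simp
  exact (Matrix.isUnit_iff_isUnit_det _).1 (IsUnit.of_mul_eq_one _ hI)

variable (h : SphChart (chartDomain U) (betaFun β) (lapse m)) (hx : x ∈ chartDomain U)
include h hx

theorem frameMetric_tetrad : frameMetric (implodingMetric β m) x (tetrad β m x) = nullForm := by
  have e : ∀ (E : Matrix (Fin 4) (Fin 4) ℂ) (A B : Matrix (Fin 4) (Fin 4) ℝ),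
      frameForm E (A + B) = frameForm E A + frameForm E B := by
    intro E A B
    ext i j
    simp [frameForm, mul_add, Finset.sum_add_distrib]
  rw [frameMetric_eq_frameForm, implodingMetric_eq, sphMetric_eq_add, e, frameForm_radMetric,
    frameForm_angMetric (h.r_ne x hx) (h.sin_ne x hx)]
  ext i j
  fin_cases i <;> fin_cases j <;> simp [nullForm, nullRad, nullAng]

theorem isUnit_det_tetrad : IsUnit (tetrad β m x).det := by
  have e := congrArg Matrix.det (frameMetric_tetrad h hx)
  have hn : nullForm.det ≠ 0 := by
    have : nullForm * nullForm = 1 := by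
      ext i j
      fin_cases i <;> fin_cases j <;> simp [nullForm, Matrix.mul_apply, Fin.sum_univ_four]
    exact ((Matrix.isUnit_iff_isUnit_det _).1 (IsUnit.of_mul_eq_one _ this)).ne_zero
  rw [frameMetric, Matrix.det_mul, Matrix.det_mul] at e
  rw [isUnit_iff_ne_zero]
  intro h0
  rw [h0, zero_mul, zero_mul] at e
  exact hn e.symm

theorem comp4_weyl (i j k l : Fin 4) :
    comp4 (tetrad β m x) (weyl (implodingMetric β m) x) i j k l
      = weylScalar (betaFun β) (lapse m) x * weylShape nullRad nullAng i j k l := by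
  have e : weyl (implodingMetric β m) x = fun a b c d => weylScalar (betaFun β) (lapse m) x *
      weylShape (radMetric (betaFun β) (lapse m) x) (angMetric x) a b c d := by
    ext a b c d
    rw [implodingMetric_eq, h.weyl_eq hx]
  rw [e, comp4_smul, comp4_weylShape, frameForm_radMetric,
    frameForm_angMetric (h.r_ne x hx) (h.sin_ne x hx)]

/-- `Ψ₂ = -α / 2`. -/
theorem psi2_eq : psi2 β m x = -(1 / 2) * weylScalar (betaFun β) (lapse m) x := by
  rw [psi2, comp4_weyl h hx]
  simp [weylShape, nullRad, nullAng]
  ring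

theorem tetradCovWeyl_eq (i j k l n : Fin 4) :
    tetradCovWeyl β m x i j k l n
      = comp1 (tetrad β m x) (fun a => pd a (weylScalar (betaFun β) (lapse m)) x) n
          * weylShape nullRad nullAng i j k l
        + ((weylScalar (betaFun β) (lapse m) x * (x 1)⁻¹ : ℝ) : ℂ)
          * covShape nullRad nullAng
            ![((1 / 2 * Real.exp (betaFun β x) * lapse m x : ℝ) : ℂ),
              ((-(Real.exp (betaFun β x))⁻¹ : ℝ) : ℂ), 0, 0] i j k l n := by
  have e : covWeyl (implodingMetric β m) x = fun a b c d e =>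
      pd e (weylScalar (betaFun β) (lapse m)) x *
        weylShape (radMetric (betaFun β) (lapse m) x) (angMetric x) a b c d
      + weylScalar (betaFun β) (lapse m) x * (x 1)⁻¹ *
        covShape (radMetric (betaFun β) (lapse m) x) (angMetric x) drCov a b c d e := by
    ext a b c d e
    rw [implodingMetric_eq, h.covWeyl_eq hx]
  rw [tetradCovWeyl, e, comp5_mul_add, comp4_weylShape, comp5_covShape, frameForm_radMetric,
    frameForm_angMetric (h.r_ne x hx) (h.sin_ne x hx),
    comp1_tetrad drCov (by simp [drCov]) (by simp [drCov])]
  simp [drCov]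

/-- `I₁ = 12 α² = 48 Ψ₂²`. -/
theorem I1_eq : I1 (implodingMetric β m) x = 12 * weylScalar (betaFun β) (lapse m) x ^ 2 := by
  have hg : IsUnit (implodingMetric β m x).det := by
    rw [implodingMetric_eq]; exact h.isUnit_det hx
  have e := normSq4_comp4 (implodingMetric β m) x (tetrad β m x) hg (isUnit_det_tetrad h hx)
    (weyl (implodingMetric β m) x)
  rw [frameMetric_tetrad h hx, nullForm_inv, normSq4_nullForm,
    show comp4 (tetrad β m x) (weyl (implodingMetric β m) x) = fun i j k l =>
      (weylScalar (betaFun β) (lapse m) x : ℂ) * weylShape nullRad nullAng i j k l from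
      funext fun i => funext fun j => funext fun k => funext fun l => comp4_weyl h hx i j k l,
    nullPair4_smul, nullPair4_weylShape] at e
  rw [I1, ← Complex.ofReal_inj, ← e]
  push_cast
  ring

end Invariants

/-! ### The invariants -/

section Invariants

variable {U : Set (ℝ × ℝ)} {β m : ℝ → ℝ → ℝ} {x : Pt}
variable (h : SphChart (chartDomain U) (betaFun β) (lapse m)) (hx : x ∈ chartDomain U)
include h hx

theorem normSq1_implodingMetric_inv (T : Fin 4 → ℝ) (h2 : T 2 = 0) (h3 : T 3 = 0) :
    normSq1 (implodingMetric β m x)⁻¹ T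
      = 2 * (Real.exp (betaFun β x))⁻¹ * T 0 * T 1 + lapse m x * T 1 ^ 2 := by
  rw [implodingMetric_eq, h.inv_eq hx]
  simp [normSq1, sphInv, Fin.sum_univ_four, h2, h3]
  ring

/-- `I₅ = (24 α)² |∇α|²`, because `I₁ = 12 α²` on an open set. -/
theorem I5_eq : I5 (implodingMetric β m) x = 576 * weylScalar (betaFun β) (lapse m) x ^ 2 *
    normSq1 (implodingMetric β m x)⁻¹ (fun a => pd a (weylScalar (betaFun β) (lapse m)) x) := by
  have hw := HasGrad.of_differentiableAt (h.radial_weylScalar.differentiableAt h.isOpen hx)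
  have e : (fun a => pd a (I1 (implodingMetric β m)) x)
      = fun a => 24 * weylScalar (betaFun β) (lapse m) x *
        pd a (weylScalar (betaFun β) (lapse m)) x := by
    ext a
    rw [pd_congr h.isOpen hx (fun y hy => I1_eq h hy)]
    simp only [pow_two]
    rw [((HasGrad.const 12).mul (hw.mul hw)).2]
    simp
    ring
  rw [I5, e]
  simp only [normSq1, Finset.mul_sum]
  refine Finset.sum_congr rfl fun _ _ => Finset.sum_congr rfl fun _ _ => by ring

/-- `I₃ = 48 |∇Ψ₂|² + 288 Ψ₂² |∇r|² / r²`, written with the Weyl scalar `-2 Ψ₂`. -/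
theorem I3_eq : I3 (implodingMetric β m) x = 12 *
      normSq1 (implodingMetric β m x)⁻¹ (fun a => pd a (weylScalar (betaFun β) (lapse m)) x)
    + 72 * weylScalar (betaFun β) (lapse m) x ^ 2 * lapse m x * ((x 1)⁻¹) ^ 2 := by
  have hw := h.radial_weylScalar
  have hg : IsUnit (implodingMetric β m x).det := by
    rw [implodingMetric_eq]; exact h.isUnit_det hx
  have e := normSq5_comp5 (implodingMetric β m) x (tetrad β m x) hg (isUnit_det_tetrad h hx)
    (covWeyl (implodingMetric β m) x)
  rw [frameMetric_tetrad h hx, nullForm_inv, normSq5_nullForm] at e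
  have ec : ∀ i j k l n, comp5 (tetrad β m x) (covWeyl (implodingMetric β m) x) i j k l n = _ :=
    tetradCovWeyl_eq h hx
  simp only [ec] at e
  rw [comp1_tetrad _ (hw.pd_two x hx) (hw.pd_three x hx)] at e
  have c0 := fun u a b c d => covShape_null_of_radial (u := u) 0 (.inl rfl) a b c d
  have c1 := fun u a b c d => covShape_null_of_radial (u := u) 1 (.inr rfl) a b c d
  -- along `ℓ` and `n` only `dα ⊗ K` survives, along `m` and `m̄` only `M`
  simp only [c0, c1, mul_zero, add_zero, Matrix.cons_val_zero, Matrix.cons_val_one,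
    Matrix.cons_val, zero_mul, zero_add, nullPair4_smul, nullPair4_weylShape] at e
  rw [nullPair4_comm (fun a b c d => covShape nullRad nullAng _ a b c d 3),
    nullPair4_covShape] at e
  rw [I3, ← Complex.ofReal_inj, ← e,
    normSq1_implodingMetric_inv h hx _ (hw.pd_two x hx) (hw.pd_three x hx)]
  have h3 : ((Real.exp (betaFun β x) : ℝ) : ℂ) ≠ 0 :=
    Complex.ofReal_ne_zero.2 (Real.exp_ne_zero _)
  simp only [Complex.ofReal_add, Complex.ofReal_mul, Complex.ofReal_inv, Complex.ofReal_neg,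
    Complex.ofReal_pow, Complex.ofReal_div, Complex.ofReal_ofNat, Complex.ofReal_one]
  field_simp
  ring

theorem spi_eq : ((spi (implodingMetric β m) x : ℝ) : ℂ)
    = 2 ^ 11 * 3 ^ 3 * ((x 1 - 2 * m (x 0) (x 1) : ℝ) : ℂ) * psi2 β m x ^ 4
      / ((x 1 : ℝ) : ℂ) ^ 3 := by
  have h1 : ((x 1 : ℝ) : ℂ) ≠ 0 := Complex.ofReal_ne_zero.2 (h.r_ne x hx)
  rw [spi, I1_eq h hx, I3_eq h hx, I5_eq h hx, psi2_eq h hx, lapse]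
  push_cast
  field_simp
  ring

/-- The last index is that of `m` or `m̄`, along which `α` is constant, so only `M` contributes. -/
theorem tetradCovWeyl_special :
    tetradCovWeyl β m x 0 1 0 3 2 = 3 * ((rho β m x : ℝ) : ℂ) * psi2 β m x ∧
    tetradCovWeyl β m x 0 3 2 3 2 = 3 * ((rho β m x : ℝ) : ℂ) * psi2 β m x ∧
    tetradCovWeyl β m x 0 1 0 2 3 = 3 * ((rho β m x : ℝ) : ℂ) * psi2 β m x ∧
    tetradCovWeyl β m x 0 2 3 2 3 = 3 * ((rho β m x : ℝ) : ℂ) * psi2 β m x := by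
  have hw := h.radial_weylScalar
  have h1 : ((x 1 : ℝ) : ℂ) ≠ 0 := Complex.ofReal_ne_zero.2 (h.r_ne x hx)
  have e := comp1_tetrad (β := β) (m := m) (x := x)
    (fun a => pd a (weylScalar (betaFun β) (lapse m)) x) (hw.pd_two x hx) (hw.pd_three x hx)
  simp only [tetradCovWeyl_eq h hx, psi2_eq h hx, e]
  refine ⟨?_, ?_, ?_, ?_⟩ <;>
    simp [covShape, nullRad, nullAng, rho, lapse, betaFun] <;> field_simp

theorem spi_eq_zero_of_eq (hm : x 1 = 2 * m (x 0) (x 1)) : spi (implodingMetric β m) x = 0 := by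
  have e := spi_eq h hx
  rw [← hm, sub_self] at e
  simpa using e

theorem spi_eq_zero_iff (hψ : psi2 β m x ≠ 0) :
    spi (implodingMetric β m) x = 0 ↔ x 1 = 2 * m (x 0) (x 1) := by
  refine ⟨fun h0 => ?_, spi_eq_zero_of_eq h hx⟩
  have e := spi_eq h hx
  have h1 : ((x 1 : ℝ) : ℂ) ≠ 0 := Complex.ofReal_ne_zero.2 (h.r_ne x hx)
  have e' : ((x 1 - 2 * m (x 0) (x 1) : ℝ) : ℂ) = 0 := by
    by_contra hne
    rw [h0, Complex.ofReal_zero] at e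
    have : (2 : ℂ) ^ 11 * 3 ^ 3 * ((x 1 - 2 * m (x 0) (x 1) : ℝ) : ℂ) * psi2 β m x ^ 4
        / ((x 1 : ℝ) : ℂ) ^ 3 ≠ 0 := by
      have h2 : (2 : ℂ) ^ 11 * 3 ^ 3 ≠ 0 := by norm_num
      exact div_ne_zero (mul_ne_zero (mul_ne_zero h2 hne) (pow_ne_zero _ hψ)) (pow_ne_zero _ h1)
    exact this e.symm
  exact sub_eq_zero.1 (Complex.ofReal_eq_zero.1 e')

end Invariants

/-! ### Null fields normal to the round spheres -/

section Horizon

variable {U : Set (ℝ × ℝ)} {β m : ℝ → ℝ → ℝ} {x : Pt}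
variable (h : SphChart (chartDomain U) (betaFun β) (lapse m))
include h

/-- The expansion of the round spheres along a field `k` normal to them is `2 k^r / r`. -/
theorem expansion_eq {N : Set Pt} (hN : IsOpen N) (hND : N ⊆ chartDomain U) {k : Pt → Fin 4 → ℝ}
    (h2 : ∀ y ∈ N, k y 2 = 0) (h3 : ∀ y ∈ N, k y 3 = 0) (hx : x ∈ N) :
    expansion (implodingMetric β m) k x = 2 * k x 1 * (x 1)⁻¹ := by
  have hr := h.r_ne x (hND hx)
  have hs := h.sin_ne x (hND hx)
  have p2 : ∀ a, pd a (fun y => k y 2) x = 0 := fun a => by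
    rw [pd_congr hN hx h2]; exact (HasGrad.const 0).2 a
  have p3 : ∀ a, pd a (fun y => k y 3) x = 0 := fun a => by
    rw [pd_congr hN hx h3]; exact (HasGrad.const 0).2 a
  have hS : sphereMetric (sphMetric (betaFun β) (lapse m)) x
      = !![x 1 ^ 2, 0; 0, x 1 ^ 2 * Real.sin (x 2) ^ 2] := by
    ext i j
    fin_cases i <;> fin_cases j <;> rfl
  have hinv : (sphereMetric (sphMetric (betaFun β) (lapse m)) x)⁻¹
      = !![(x 1 ^ 2)⁻¹, 0; 0, (x 1 ^ 2 * Real.sin (x 2) ^ 2)⁻¹] := by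
    rw [hS]
    apply Matrix.inv_eq_right_inv
    ext i j
    fin_cases i <;> fin_cases j <;> simp [hr]
    field_simp
  simp only [expansion, covVec, implodingMetric_eq, hinv, h.christoffel_eq (hND hx),
    Fin.sum_univ_four, Fin.sum_univ_two]
  simp [sphMetric, gam, p2, p3, h2 x hx, h3 x hx]
  field_simp
  ring

/-- A future null field normal to the round spheres is, at each point, a positive multiple of the
ingoing field `n` or a positive multiple of the outgoing field `ℓ`. -/
theorem IsFutureNullNormal.cases {N : Set Pt} (hND : N ⊆ chartDomain U) {k : Pt → Fin 4 → ℝ}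
    (hk : IsFutureNullNormal β m N k) (hx : x ∈ N) :
    k x 2 = 0 ∧ k x 3 = 0 ∧ ((k x 0 = 0 ∧ k x 1 < 0) ∨
      (0 < k x 0 ∧ k x 1 = 1 / 2 * Real.exp (betaFun β x) * lapse m x * k x 0)) := by
  have hr := h.r_ne x (hND hx)
  have hs := h.sin_ne x (hND hx)
  have hE := Real.exp_pos (betaFun β x)
  have e1 := hk.normal_theta x hx
  have e2 := hk.normal_phi x hx
  have e3 := hk.null x hx
  have e4 := hk.future x hx
  rw [implodingMetric_eq] at e1 e2 e3 e4
  simp [ip, sphMetric, Fin.sum_univ_four, hr, hs] at e1 e2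
  refine ⟨e1, e2, ?_⟩
  have ht : timeField β m x = ![1, 1 / 2 * Real.exp (betaFun β x) * lapse m x
      - (Real.exp (betaFun β x))⁻¹, 0, 0] := by
    ext i
    fin_cases i <;>
      simp [timeField, ell, enn, betaFun, lapse, Real.exp_neg, div_eq_mul_inv, sub_eq_add_neg]
  simp only [ip, sphMetric, Fin.sum_univ_four, ht] at e3 e4
  simp [e1, e2] at e3 e4
  -- the null condition factors: one factor vanishes on `n`, the other one on `ℓ`
  have f3 : k x 0 * (1 / 2 * Real.exp (betaFun β x) * lapse m x * k x 0 - k x 1) = 0 := by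
    have : Real.exp (betaFun β x) *
        (k x 0 * (1 / 2 * Real.exp (betaFun β x) * lapse m x * k x 0 - k x 1)) = 0 := by
      linear_combination (-1 / 2) * e3
    exact (mul_eq_zero.1 this).resolve_left hE.ne'
  have f4 : Real.exp (betaFun β x) * k x 1
      - 1 / 2 * Real.exp (betaFun β x) ^ 2 * lapse m x * k x 0 - k x 0 < 0 := by
    have : Real.exp (betaFun β x) * (Real.exp (betaFun β x))⁻¹ = 1 := mul_inv_cancel₀ hE.ne'
    linear_combination e4 + k x 0 * this
  rcases mul_eq_zero.1 f3 with h0 | h0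
  · left
    refine ⟨h0, ?_⟩
    rw [h0] at f4
    by_contra hc
    have := mul_nonneg hE.le (not_lt.1 hc)
    linarith
  · right
    have hk1 : k x 1 = 1 / 2 * Real.exp (betaFun β x) * lapse m x * k x 0 := by linarith
    refine ⟨?_, hk1⟩
    rw [hk1] at f4
    linarith

theorem IsFutureNullNormal.expansion_eq {N : Set Pt} (hN : IsOpen N) (hND : N ⊆ chartDomain U)
    {k : Pt → Fin 4 → ℝ} (hk : IsFutureNullNormal β m N k) (hx : x ∈ N) :
    expansion (implodingMetric β m) k x = 2 * k x 1 * (x 1)⁻¹ :=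
  SphHorizon.expansion_eq h hN hND (fun _ hy => (hk.cases h hND hy).1)
    (fun _ hy => (hk.cases h hND hy).2.1) hx

theorem lapse_eq_zero_iff (hx : x ∈ chartDomain U) :
    lapse m x = 0 ↔ x 1 = 2 * m (x 0) (x 1) := by
  have hr := h.r_ne x hx
  rw [lapse, sub_eq_zero, eq_comm, mul_inv_eq_one₀ hr, eq_comm]

/-- On a marginally trapped tube the field with vanishing expansion is outgoing, the other one is
ingoing, and `F = 1 - 2m/r` vanishes. -/
theorem IsTrappedTube.null_fields (hr : ∀ p ∈ U, 0 < p.2) {H N : Set Pt} {l n : Pt → Fin 4 → ℝ}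
    (ht : IsTrappedTube β m U H N l n) (hx : x ∈ H) :
    lapse m x = 0 ∧ 0 < l x 0 ∧ n x 0 = 0 ∧ n x 1 < 0 := by
  have hxN := ht.subset_nhd hx
  have r0 : 0 < x 1 := hr _ (ht.nhd_subset hxN).1
  have el := ht.expansion_l x hx
  have en := ht.expansion_n x hx
  rw [ht.normal_l.expansion_eq h ht.isOpen ht.nhd_subset hxN] at el
  rw [ht.normal_n.expansion_eq h ht.isOpen ht.nhd_subset hxN] at en
  have l1 : l x 1 = 0 := by simpa [r0.ne'] using el
  have n1 : n x 1 < 0 := by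
    by_contra hc
    have := mul_nonneg (not_lt.1 hc) (inv_pos.2 r0).le
    linarith
  have hE := Real.exp_ne_zero (betaFun β x)
  obtain ⟨-, -, ⟨-, hl⟩ | ⟨hl0, hl⟩⟩ := ht.normal_l.cases h ht.nhd_subset hxN
  · exact absurd l1 hl.ne
  have hF : lapse m x = 0 := by
    rw [l1] at hl
    simpa [hE, hl0.ne'] using hl.symm
  obtain ⟨-, -, ⟨hn0, -⟩ | ⟨hn0, hn⟩⟩ := ht.normal_n.cases h ht.nhd_subset hxN
  · exact ⟨hF, hl0, hn0, n1⟩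
  · rw [hF] at hn
    simp only [mul_zero, zero_mul] at hn
    exact absurd hn n1.ne

/-- If `l` is outgoing and `n` ingoing at a zero of `F`, then `L_n θ_(l)` is the product of `∂_r F`
with `n^r e^β l^v / r`. -/
theorem lie_expansion {N : Set Pt} (hN : IsOpen N)
    (hND : N ⊆ chartDomain U) {l : Pt → Fin 4 → ℝ}
    (hl : IsFutureNullNormal β m N l) (hx : x ∈ N) (hF : lapse m x = 0) (hl0 : 0 < l x 0)
    (w : Fin 4 → ℝ) (w0 : w 0 = 0) (w2 : w 2 = 0) (w3 : w 3 = 0) :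
    ∑ a, w a * pd a (expansion (implodingMetric β m) l) x
      = w 1 * (Real.exp (betaFun β x) * l x 0 * (x 1)⁻¹) * pd 1 (lapse m) x := by
  have hc : ContDiffOn ℝ ∞ (fun y => l y 0) N := contDiffOn_pi.1 hl.smooth 0
  have hV : IsOpen (N ∩ (fun y => l y 0) ⁻¹' Set.Ioi 0) :=
    hc.continuousOn.isOpen_inter_preimage hN isOpen_Ioi
  -- where `l^v > 0` the field `l` is a multiple of `ℓ`, so its expansion is a multiple of `F`
  have e : ∀ y ∈ N ∩ (fun y => l y 0) ⁻¹' Set.Ioi 0, expansion (implodingMetric β m) l y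
      = lapse m y * (Real.exp (betaFun β y) * l y 0 * (y 1)⁻¹) := by
    rintro y ⟨hy, hy0⟩
    rw [hl.expansion_eq h hN hND hy]
    obtain ⟨-, -, ⟨h0, -⟩ | ⟨-, h1⟩⟩ := hl.cases h hND hy
    · exact absurd h0 (ne_of_gt hy0)
    · rw [h1]; ring
  have hx' := hND hx
  have dl : DifferentiableAt ℝ (fun y => l y 0) x :=
    (hc.contDiffAt (hN.mem_nhds hx)).differentiableAt (by simp)
  have g := (HasGrad.of_differentiableAt (h.hF.differentiableAt h.isOpen hx')).mul
    (((h.hb.hasGrad h.isOpen hx').exp.mul (.of_differentiableAt dl)).mul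
      ((HasGrad.coord 1).inv (h.r_ne x hx')))
  have e1 : pd 1 (expansion (implodingMetric β m) l) x = _ :=
    (pd_congr hV ⟨hx, hl0⟩ e 1).trans (g.2 1)
  -- the derivatives of the factor of `F` are multiplied by `F = 0`
  simp only [Fin.sum_univ_four, w0, w2, w3, e1, hF]
  ring

end Horizon

/-! ### Horizons -/

theorem pd_zero_eq_deriv {f : ℝ → ℝ → ℝ} {x : Pt}
    (hd : DifferentiableAt ℝ (fun y : Pt => f (y 0) (y 1)) x) :
    pd 0 (fun y => f (y 0) (y 1)) x = deriv (fun v => f v (x 1)) (x 0) := by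
  rw [pd, ← hd.lineDeriv_eq_fderiv, lineDeriv]
  simp [deriv_comp_const_add (f := fun v => f v (x 1))]

theorem pd_one_eq_deriv {f : ℝ → ℝ → ℝ} {x : Pt}
    (hd : DifferentiableAt ℝ (fun y : Pt => f (y 0) (y 1)) x) :
    pd 1 (fun y => f (y 0) (y 1)) x = deriv (fun r => f (x 0) r) (x 1) := by
  rw [pd, ← hd.lineDeriv_eq_fderiv, lineDeriv]
  simp [deriv_comp_const_add (f := fun r => f (x 0) r)]

section Horizon

variable {U : Set (ℝ × ℝ)} {β m : ℝ → ℝ → ℝ} {x : Pt}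

/-- The radial derivative of `1 - 2m/r` at a point of `r = 2m`. -/
theorem pd_one_lapse (hm : DifferentiableAt ℝ (fun y : Pt => m (y 0) (y 1)) x) (hr : x 1 ≠ 0)
    (h : x 1 = 2 * m (x 0) (x 1)) :
    pd 1 (lapse m) x = (1 - 2 * deriv (fun r => m (x 0) r) (x 1)) * (x 1)⁻¹ := by
  have g := ((HasGrad.const 1).sub (((HasGrad.const 2).mul (.of_differentiableAt hm)).mul
    ((HasGrad.coord 1).inv hr))).2 1
  refine g.trans ?_
  beta_reduce
  rw [pd_one_eq_deriv hm, ← h]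
  simp
  field_simp
  ring

variable (h : SphChart (chartDomain U) (betaFun β) (lapse m))
include h

theorem isFutureNullNormal_ell : IsFutureNullNormal β m (chartDomain U) (ell β m) := by
  have hE := fun x => Real.exp_ne_zero (betaFun β x)
  have key : ∀ x, ell β m x = ![1, 1 / 2 * Real.exp (betaFun β x) * lapse m x, 0, 0] := by
    intro x
    simp only [ell, betaFun, lapse, div_eq_mul_inv]
  have ht : ∀ x, timeField β m x = ![1, 1 / 2 * Real.exp (betaFun β x) * lapse m x
      - (Real.exp (betaFun β x))⁻¹, 0, 0] := by
    intro x
    ext i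
    fin_cases i <;>
      simp [timeField, ell, enn, betaFun, lapse, Real.exp_neg, div_eq_mul_inv, sub_eq_add_neg]
  rw [show ell β m = _ from funext key]
  refine ⟨?_, ?_, ?_, ?_, ?_⟩
  · rw [contDiffOn_pi]
    intro i
    fin_cases i
    · exact contDiffOn_const
    · exact (contDiffOn_const.mul h.hb.smooth.exp).mul h.hF.smooth
    · exact contDiffOn_const
    · exact contDiffOn_const
  · intro x _
    rw [implodingMetric_eq]
    simp [ip, sphMetric, Fin.sum_univ_four]
    ring
  · intro x _
    have e : ip (sphMetric (betaFun β) (lapse m)) x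
        ![1, 1 / 2 * Real.exp (betaFun β x) * lapse m x, 0, 0] (timeField β m x) = -1 := by
      have hE := hE x
      rw [ht]
      simp [ip, sphMetric, Fin.sum_univ_four]
      field_simp
      ring
    rw [implodingMetric_eq, e]
    norm_num
  · intro x _
    rw [implodingMetric_eq]
    simp [ip, sphMetric, Fin.sum_univ_four]
  · intro x _
    rw [implodingMetric_eq]
    simp [ip, sphMetric, Fin.sum_univ_four]

theorem isFutureNullNormal_enn : IsFutureNullNormal β m (chartDomain U) (enn β) := by
  refine ⟨?_, ?_, ?_, ?_, ?_⟩
  · rw [contDiffOn_pi]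
    intro i
    fin_cases i
    · exact contDiffOn_const
    · exact (h.hb.smooth.neg.exp).neg
    · exact contDiffOn_const
    · exact contDiffOn_const
  · intro x _
    simp [ip, implodingMetric, enn, Fin.sum_univ_four]
  · intro x _
    simp [ip, implodingMetric, enn, timeField, ell, Fin.sum_univ_four, ← Real.exp_add]
  · intro x _
    simp [ip, implodingMetric, enn, Fin.sum_univ_four]
  · intro x _
    simp [ip, implodingMetric, enn, Fin.sum_univ_four]

/-- Every hypersurface of round spheres in `r = 2m` is a marginally trapped tube, with the null
fields `ℓ` and `n`. -/
theorem isTrappedTube_of_subset (hr : ∀ p ∈ U, 0 < p.2) {H : Set Pt} (hD : H ⊆ chartDomain U)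
    (hH : ∀ x ∈ H, x 1 = 2 * m (x 0) (x 1))
    (hyp : ∀ x ∈ H, ∃ V f, x ∈ V ∧ IsDefining H V f)
    (sph : ∀ x ∈ H, ∀ y ∈ chartDomain U, y 0 = x 0 → y 1 = x 1 → y ∈ H) :
    IsTrappedTube β m U H (chartDomain U) (ell β m) (enn β) where
  isOpen := h.isOpen
  subset_nhd := hD
  nhd_subset := subset_rfl
  hypersurface := hyp
  spheres := sph
  normal_l := isFutureNullNormal_ell h
  normal_n := isFutureNullNormal_enn h
  distinct x _ := by
    simp [ip, implodingMetric, enn, ell, Fin.sum_univ_four]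
  expansion_l x hx := by
    rw [(isFutureNullNormal_ell h).expansion_eq h h.isOpen subset_rfl (hD hx)]
    have := (lapse_eq_zero_iff h (hD hx)).2 (hH x hx)
    rw [lapse, ← div_eq_mul_inv] at this
    simp [ell, this]
  expansion_n x hx := by
    rw [(isFutureNullNormal_enn h).expansion_eq h h.isOpen subset_rfl (hD hx)]
    have r0 : 0 < x 1 := hr _ (hD hx).1
    have : 0 < Real.exp (-β (x 0) (x 1)) * (x 1)⁻¹ := by positivity
    simp only [enn, Matrix.cons_val_one, Matrix.cons_val_zero]
    linarith

omit h in
/-- `r - 2m` is a defining function of a part of `r = 2m` that is open in it and on which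
`2 m_r ≠ 1`; its gradient is included for the causal character of the hypersurface. -/
theorem isDefining_sub (hM : Radial (chartDomain U) (fun x => m (x 0) (x 1)))
    (hO : IsOpen (chartDomain U)) {H V : Set Pt}
    (hV : IsOpen V) (hVD : V ⊆ chartDomain U)
    (hreg : ∀ y ∈ V, 1 - 2 * deriv (fun r => m (y 0) r) (y 1) ≠ 0)
    (hH : ∀ y ∈ V, y ∈ H ↔ y 1 = 2 * m (y 0) (y 1)) :
    IsDefining H V (fun y => y 1 - 2 * m (y 0) (y 1)) ∧ ∀ y ∈ V,
      ∀ a, pd a (fun y => y 1 - 2 * m (y 0) (y 1)) y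
        = ![-(2 * deriv (fun v => m v (y 1)) (y 0)),
            1 - 2 * deriv (fun r => m (y 0) r) (y 1), 0, 0] a := by
  have hR : Radial (chartDomain U) (fun y => y 1 - 2 * m (y 0) (y 1)) :=
    .sub hO .coord_one (.mul hO (.const 2) hM)
  have hg : ∀ y ∈ V, ∀ a, pd a (fun y => y 1 - 2 * m (y 0) (y 1)) y
        = ![-(2 * deriv (fun v => m v (y 1)) (y 0)),
            1 - 2 * deriv (fun r => m (y 0) r) (y 1), 0, 0] a := by
    intro y hy a
    have hd := hM.differentiableAt hO (hVD hy)
    have g := (HasGrad.coord (x := y) 1).sub ((HasGrad.const 2).mul (hM.hasGrad hO (hVD hy)))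
    rw [pd_zero_eq_deriv hd, pd_one_eq_deriv hd] at g
    rw [g.2]
    fin_cases a <;> simp
  refine ⟨⟨hV, hR.smooth.mono hVD, fun y hy _ h0 => hreg y hy ?_, fun y hy => ?_⟩, hg⟩
  · have e := hg y hy 1
    rw [pd, h0] at e
    exact e.symm
  · rw [hH y hy, sub_eq_zero]

theorem isFOTH_set (hr : ∀ p ∈ U, 0 < p.2)
    (hM : Radial (chartDomain U) (fun x => m (x 0) (x 1))) :
    IsFOTH β m U {x | x ∈ chartDomain U ∧ x 1 = 2 * m (x 0) (x 1) ∧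
      2 * deriv (fun r => m (x 0) r) (x 1) < 1} := by
  have hO := h.isOpen
  have hV : IsOpen (chartDomain U ∩ {x | 2 * deriv (fun r => m (x 0) r) (x 1) < 1}) := by
    have := (hM.pd hO 1).smooth.continuousOn.isOpen_inter_preimage hO (isOpen_Iio (a := 1 / 2))
    refine (congrArg IsOpen (Set.ext fun x => and_congr_right fun hx => ?_)).mp this
    simp only [Set.mem_ofPred_eq, Set.mem_preimage, Set.mem_Iio,
      pd_one_eq_deriv (hM.differentiableAt hO hx)]
    constructor <;> intro <;> linarith
  have hdef := isDefining_sub hM hO hV Set.inter_subset_left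
    (H := {x | x ∈ chartDomain U ∧ x 1 = 2 * m (x 0) (x 1) ∧
      2 * deriv (fun r => m (x 0) r) (x 1) < 1})
    (fun y hy => (sub_pos.2 hy.2).ne') (fun y hy => ⟨fun h => h.2.1, fun h => ⟨hy.1, h, hy.2⟩⟩)
  refine ⟨chartDomain U, ell β m, enn β, isTrappedTube_of_subset h hr (fun x hx => hx.1)
    (fun x hx => hx.2.1) (fun x hx => Exists.intro _ ⟨_, And.intro hx.1 hx.2.2, hdef.1⟩) ?_, ?_⟩
  · rintro x ⟨-, h1, h2⟩ y hy e0 e1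
    refine ⟨hy, ?_, ?_⟩
    · rw [e0, e1]; exact h1
    · rw [e0, e1]; exact h2
  · rintro x ⟨hx, h1, h2⟩
    have r0 : 0 < x 1 := hr _ hx.1
    rw [lie_expansion h hO subset_rfl (isFutureNullNormal_ell h) hx
      ((lapse_eq_zero_iff h hx).2 h1) (by simp [ell]) _ (by simp [enn]) (by simp [enn])
      (by simp [enn]), pd_one_lapse (hM.differentiableAt hO hx) r0.ne' h1]
    have e1 : 0 < 1 - 2 * deriv (fun r => m (x 0) r) (x 1) := sub_pos.2 h2
    have e2 : 0 < Real.exp (-β (x 0) (x 1)) * (Real.exp (betaFun β x) * ell β m x 0 * (x 1)⁻¹) *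
        ((1 - 2 * deriv (fun r => m (x 0) r) (x 1)) * (x 1)⁻¹) := by
      have : ell β m x 0 = 1 := rfl
      rw [this]
      positivity
    have e3 : enn β x 1 = -Real.exp (-β (x 0) (x 1)) := rfl
    rw [e3]
    linarith

theorem isDynamicalHorizon_set (hr : ∀ p ∈ U, 0 < p.2)
    (hM : Radial (chartDomain U) (fun x => m (x 0) (x 1))) :
    IsDynamicalHorizon β m U {x | x ∈ chartDomain U ∧ x 1 = 2 * m (x 0) (x 1) ∧
      0 < deriv (fun v => m v (x 1)) (x 0) * (1 - 2 * deriv (fun r => m (x 0) r) (x 1))} := by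
  have hO := h.isOpen
  have hV : IsOpen (chartDomain U ∩ {x | 0 < deriv (fun v => m v (x 1)) (x 0) *
      (1 - 2 * deriv (fun r => m (x 0) r) (x 1))}) := by
    have := (Radial.mul hO (hM.pd hO 0) (.sub hO (.const 1) (.mul hO (.const 2)
      (hM.pd hO 1)))).smooth.continuousOn.isOpen_inter_preimage hO (isOpen_Ioi (a := 0))
    refine (congrArg IsOpen (Set.ext fun x => and_congr_right fun hx => ?_)).mp this
    simp only [Set.mem_ofPred_eq, Set.mem_preimage, Set.mem_Ioi,
      pd_zero_eq_deriv (hM.differentiableAt hO hx), pd_one_eq_deriv (hM.differentiableAt hO hx)]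
  have hdef := isDefining_sub hM hO hV Set.inter_subset_left
    (H := {x | x ∈ chartDomain U ∧ x 1 = 2 * m (x 0) (x 1) ∧
      0 < deriv (fun v => m v (x 1)) (x 0) * (1 - 2 * deriv (fun r => m (x 0) r) (x 1))})
    (fun y hy => right_ne_zero_of_mul (ne_of_gt hy.2))
    (fun y hy => ⟨fun h => h.2.1, fun h => ⟨hy.1, h, hy.2⟩⟩)
  refine ⟨chartDomain U, ell β m, enn β, isTrappedTube_of_subset h hr (fun x hx => hx.1)
    (fun x hx => hx.2.1) (fun x hx => Exists.intro _ ⟨_, And.intro hx.1 hx.2.2, hdef.1⟩) ?_,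
    fun x hx => Exists.intro _ ⟨_, And.intro hx.1 hx.2.2, hdef.1, ?_⟩⟩
  · rintro x ⟨-, h1, h2⟩ y hy e0 e1
    refine ⟨hy, ?_, ?_⟩
    · rw [e0, e1]; exact h1
    · rw [e0, e1]; exact h2
  · obtain ⟨hx, h1, h2⟩ := hx
    have hg := hdef.2 x ⟨hx, h2⟩
    rw [normSq1_implodingMetric_inv h hx _ (hg 2) (hg 3), (lapse_eq_zero_iff h hx).2 h1, hg 0, hg 1]
    have := mul_pos (inv_pos.2 (Real.exp_pos (betaFun β x))) h2
    simp only [Matrix.cons_val_zero, Matrix.cons_val_one]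
    linarith

theorem IsTrappedTube.eq_two_mul (hr : ∀ p ∈ U, 0 < p.2) {H N : Set Pt} {l n : Pt → Fin 4 → ℝ}
    (ht : IsTrappedTube β m U H N l n) (hx : x ∈ H) :
    x ∈ chartDomain U ∧ x 1 = 2 * m (x 0) (x 1) :=
  have hxD := ht.nhd_subset (ht.subset_nhd hx)
  ⟨hxD, (lapse_eq_zero_iff h hxD).1 (ht.null_fields h hr hx).1⟩

theorem IsFOTH.two_mul_deriv_lt (hr : ∀ p ∈ U, 0 < p.2)
    (hM : Radial (chartDomain U) (fun x => m (x 0) (x 1))) {H : Set Pt}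
    (hH : IsFOTH β m U H) (hx : x ∈ H) :
    x ∈ chartDomain U ∧ x 1 = 2 * m (x 0) (x 1) ∧ 2 * deriv (fun r => m (x 0) r) (x 1) < 1 := by
  obtain ⟨N, l, n, ht, hL⟩ := hH
  obtain ⟨hxD, h1⟩ := ht.eq_two_mul h hr hx
  refine ⟨hxD, h1, ?_⟩
  have r0 : 0 < x 1 := hr _ hxD.1
  obtain ⟨hF, hl0, hn0, hn1⟩ := ht.null_fields h hr hx
  have hxN := ht.subset_nhd hx
  obtain ⟨hn2, hn3, -⟩ := ht.normal_n.cases h ht.nhd_subset hxN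
  have e := hL x hx
  rw [lie_expansion h ht.isOpen ht.nhd_subset ht.normal_l hxN hF hl0 _ hn0 hn2 hn3,
    pd_one_lapse (hM.differentiableAt h.isOpen hxD) r0.ne' h1] at e
  by_contra hc
  have e1 : 0 ≤ 2 * deriv (fun r => m (x 0) r) (x 1) - 1 := by linarith
  have e2 : 0 ≤ (-n x 1) * (Real.exp (betaFun β x) * l x 0 * (x 1)⁻¹) *
      ((2 * deriv (fun r => m (x 0) r) (x 1) - 1) * (x 1)⁻¹) := by
    have : 0 < -n x 1 := by linarith
    positivity
  linarith

end Horizon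

end SphHorizon

end

theorem mainTheorem4 (U : Set (ℝ × ℝ)) (hU : IsOpen U) (hr : ∀ p ∈ U, 0 < p.2)
    (β m : ℝ → ℝ → ℝ)
    (hβ : ContDiffOn ℝ ∞ (fun p : ℝ × ℝ => β p.1 p.2) U)
    (hm : ContDiffOn ℝ ∞ (fun p : ℝ × ℝ => m p.1 p.2) U) :
    -- the formula for the invariant
    (∀ x ∈ SphHorizon.chartDomain U,
      ((SphHorizon.spi (SphHorizon.implodingMetric β m) x : ℝ) : ℂ)
        = 2 ^ 11 * 3 ^ 3 * ((x 1 - 2 * m (x 0) (x 1) : ℝ) : ℂ) * SphHorizon.psi2 β m x ^ 4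
            / ((x 1 : ℝ) : ℂ) ^ 3) ∧
    -- its value does not depend on the frame
    (∀ x ∈ SphHorizon.chartDomain U, ∀ E : Matrix (Fin 4) (Fin 4) ℂ, IsUnit E.det →
      SphHorizon.frameSpi (SphHorizon.implodingMetric β m) x E
        = ((SphHorizon.spi (SphHorizon.implodingMetric β m) x : ℝ) : ℂ)) ∧
    -- the change of structure of the covariant derivative of the Weyl tensor
    (∀ x ∈ SphHorizon.chartDomain U,
      SphHorizon.tetradCovWeyl β m x 0 1 0 3 2
        = 3 * ((SphHorizon.rho β m x : ℝ) : ℂ) * SphHorizon.psi2 β m x ∧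
      SphHorizon.tetradCovWeyl β m x 0 3 2 3 2
        = 3 * ((SphHorizon.rho β m x : ℝ) : ℂ) * SphHorizon.psi2 β m x ∧
      SphHorizon.tetradCovWeyl β m x 0 1 0 2 3
        = 3 * ((SphHorizon.rho β m x : ℝ) : ℂ) * SphHorizon.psi2 β m x ∧
      SphHorizon.tetradCovWeyl β m x 0 2 3 2 3
        = 3 * ((SphHorizon.rho β m x : ℝ) : ℂ) * SphHorizon.psi2 β m x) ∧
    -- detection of the surface `r = 2m`
    (∀ x ∈ SphHorizon.chartDomain U,
      (x 1 = 2 * m (x 0) (x 1) →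
        SphHorizon.spi (SphHorizon.implodingMetric β m) x = 0 ∧
        SphHorizon.tetradCovWeyl β m x 0 1 0 3 2 = 0 ∧
        SphHorizon.tetradCovWeyl β m x 0 3 2 3 2 = 0 ∧
        SphHorizon.tetradCovWeyl β m x 0 1 0 2 3 = 0 ∧
        SphHorizon.tetradCovWeyl β m x 0 2 3 2 3 = 0) ∧
      (SphHorizon.psi2 β m x ≠ 0 →
        (SphHorizon.spi (SphHorizon.implodingMetric β m) x = 0 ↔ x 1 = 2 * m (x 0) (x 1)))) ∧
    -- future outer trapping horizons
    SphHorizon.IsFOTH β m U {x | x ∈ SphHorizon.chartDomain U ∧ x 1 = 2 * m (x 0) (x 1) ∧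
      2 * deriv (fun r => m (x 0) r) (x 1) < 1} ∧
    (∀ H : Set SphHorizon.Pt, SphHorizon.IsFOTH β m U H → ∀ x ∈ H,
      x 1 = 2 * m (x 0) (x 1) ∧ 2 * deriv (fun r => m (x 0) r) (x 1) < 1 ∧
      SphHorizon.spi (SphHorizon.implodingMetric β m) x = 0) ∧
    -- dynamical horizons
    SphHorizon.IsDynamicalHorizon β m U {x | x ∈ SphHorizon.chartDomain U ∧
      x 1 = 2 * m (x 0) (x 1) ∧
      0 < deriv (fun v => m v (x 1)) (x 0) * (1 - 2 * deriv (fun r => m (x 0) r) (x 1))} ∧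
    (∀ H : Set SphHorizon.Pt, SphHorizon.IsDynamicalHorizon β m U H → ∀ x ∈ H,
      x 1 = 2 * m (x 0) (x 1) ∧
      SphHorizon.spi (SphHorizon.implodingMetric β m) x = 0) := by
  have h := SphHorizon.sphChart hU hr hβ hm
  have hM := SphHorizon.radial_comp hU hm
  refine ⟨fun x hx => SphHorizon.spi_eq h hx, fun x hx E hE => ?_,
    fun x hx => SphHorizon.tetradCovWeyl_special h hx, fun x hx => ⟨fun h1 => ?_, fun hψ =>
      SphHorizon.spi_eq_zero_iff h hx hψ⟩, SphHorizon.isFOTH_set h hr hM, fun H hH x hx => ?_,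
    SphHorizon.isDynamicalHorizon_set h hr hM, fun H hH x hx => ?_⟩
  · refine SphHorizon.frameSpi_eq _ x E ?_ hE
    rw [SphHorizon.implodingMetric_eq]
    exact h.isUnit_det hx
  · obtain ⟨e1, e2, e3, e4⟩ := SphHorizon.tetradCovWeyl_special h hx
    have hρ : SphHorizon.rho β m x = 0 := by
      rw [SphHorizon.rho, ← h1]
      simp
    rw [e1, e2, e3, e4, hρ]
    simpa using SphHorizon.spi_eq_zero_of_eq h hx h1
  · obtain ⟨hxD, h1, h2⟩ := hH.two_mul_deriv_lt h hr hM hx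
    exact ⟨h1, h2, SphHorizon.spi_eq_zero_of_eq h hxD h1⟩
  · obtain ⟨N, l, n, ht, -⟩ := hH
    obtain ⟨hxD, h1⟩ := ht.eq_two_mul h hr hx
    exact ⟨h1, SphHorizon.spi_eq_zero_of_eq h hxD h1⟩
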